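/- Let $p$ be a prime, $n\ge 1$, $a>0$, $\alpha>0$, $0\le\lambda<\alpha$ and $T>0$. Let $\|x\|_p=\max_i|x_i|_p$ on $\mathbb{Q}_p^n$, let $d^nx$ be the Haar measure on $\mathbb{Q}_p^n$ with $\int_{\mathbb{Z}_p^n}d^nx=1$, and let $\Psi(x)=e^{2\pi i\{x\}_p}$ be the standard additive character of $\mathbb{Q}_p$, where $\{x\}_p$ is the $p$-adic fractional part. Put $$Z(x,t)=\int_{\mathbb{Q}_p^n}\Psi(x\cdot\xi)\,e^{-at\|\xi\|_p^\alpha}\,d^n\xi\qquad(t>0),$$ and let the Taibleson operator act by $$(D_T^\alpha\varphi)(x)=\frac{1-p^{\alpha}}{1-p^{-\alpha-n}}\int_{\mathbb{Q}_p^n}\|y\|_p^{-\alpha-n}\,(\varphi(x-y)-\varphi(x))\,d^ny$$ whenever the integral converges absolutely. Let $\mathfrak{M}_\lambda$ be the set of locally constant functions $\varphi:\mathbb{Q}_p^n\to\mathbb{C}$ such that $|\varphi(x)|\le C(1+\|x\|_p^\lambda)$ for some constant $C$. A function $g(x,t)$ is in $\mathfrak{M}_\lambda$ uniformly with respect to $t$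 if $|g(x,t)|\le C(1+\|x\|_p^\lambda)$ with $C$ independent of $t$ and if for every $x$ there is an integer $l(x)$, independent of $t$, such that $g(x+y,t)=g(x,t)$ whenever $\|y\|_p\le p^{l(x)}$. Let $\varphi\in\mathfrak{M}_\lambda$, and let $f(x,t)$ be continuous on $\mathbb{Q}_p^n\times(0,T]$ and in $\mathfrak{M}_\lambda$ uniformly with respect to $t\in(0,T]$. Then the Cauchy problem $$\frac{\partial u}{\partial t}(x,t)+a(D_T^\alpha u)(x,t)=f(x,t),\quad x\in\mathbb{Q}_p^n,\ t\in(0,T],\qquad u(x,0)=\varphi(x),$$ has a solution $u$ that is continuous on $\mathbb{Q}_p^n\times[0,T]$ and in $\mathfrak{M}_\lambda$ uniformly with respect to $t\in[0,T]$ (the integral defining $D_T^\alpha u$ converges absolutely, and the $t$-derivative at $t=T$ is one-sided). For $t\in(0,T]$ it is given, with absolutely convergent integrals, by $$u(x,t)=\int_{\mathbb{Q}_p^n}Z(x-\xi,t)\varphi(\xi)\,d^n\xi+\int_0^t\left(\int_{\mathbb{Q}_p^n}Z(x-\xi,t-\tau)f(\xi,\tau)\,d^n\xi\right)d\tau .$$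 Moreover, if $\varphi$ and all $f(\cdot,t)$, $t\in(0,T]$, are invariant under translation by every $y$ with $\|y\|_p\le p^{l}$ for a fixed integer $l$, then so are all $u(\cdot,t)$, $t\in[0,T]$. -/

import Mathlib

open MeasureTheory Set

namespace PadicHeat

noncomputable section

/-- The Borel sigma-algebra on `ℚ_[p]`. -/
instance instMeasurableSpacePadic (p : ℕ) [Fact p.Prime] : MeasurableSpace ℚ_[p] :=
  borel ℚ_[p]

instance instBorelSpacePadic (p : ℕ) [Fact p.Prime] : BorelSpace ℚ_[p] := ⟨rfl⟩

/-- The closed unit ball `ℤ_p` of `ℚ_[p]`, a compact set with non-empty interior. -/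
def unitBall (p : ℕ) [Fact p.Prime] : TopologicalSpace.PositiveCompacts ℚ_[p] where
  carrier := Metric.closedBall 0 1
  isCompact' := isCompact_closedBall 0 1
  interior_nonempty' :=
    ⟨0, Metric.ball_subset_interior_closedBall (Metric.mem_ball_self one_pos)⟩

/-- The Haar measure on `ℚ_[p]` that gives `ℤ_p` the measure `1`.  The measure `volume` on
`Fin n → ℚ_[p]` is then the product measure, that is, the Haar measure `d^n x` that gives the
closed unit ball the measure `1`. -/
instance instMeasureSpacePadic (p : ℕ) [Fact p.Prime] : MeasureSpace ℚ_[p] where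
  volume := Measure.addHaarMeasure (unitBall p)

theorem norm_mul_pow_le_one {p : ℕ} [Fact p.Prime] (x : ℚ_[p]) :
    ‖x * (p : ℚ_[p]) ^ (-x.valuation).toNat‖ ≤ 1 := by
  rcases eq_or_ne x 0 with rfl | hx
  · simp
  · have hp : (1 : ℝ) < p := by exact_mod_cast (Fact.out : p.Prime).one_lt
    rw [norm_mul, norm_pow, Padic.norm_p, Padic.norm_eq_zpow_neg_valuation hx, inv_pow,
      ← zpow_natCast, ← zpow_neg, ← zpow_add₀ (by positivity)]
    apply zpow_le_one_of_nonpos₀ hp.le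
    have := Int.self_le_toNat (-x.valuation)
    linarith

/-- The `p`-adic integer `p ^ m * x`, where `m = max (-ord x) 0`. -/
def clearDenom {p : ℕ} [Fact p.Prime] (x : ℚ_[p]) : ℤ_[p] :=
  ⟨x * (p : ℚ_[p]) ^ (-x.valuation).toNat, norm_mul_pow_le_one x⟩

/-- The fractional part of a `p`-adic number: with `m = max (-ord x) 0`, it is
`p ^ (-m) * ∑_{j < m} x_j p ^ j`, where `∑_j x_j p ^ j` is the `p`-adic expansion of
`p ^ m * x ∈ ℤ_p` with digits in `{0, …, p - 1}` (`PadicInt.appr z m` is the sum of the first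
`m` terms of the expansion of `z`).  It is `0` if `x = 0` or `ord x ≥ 0`. -/
def fracPart {p : ℕ} [Fact p.Prime] (x : ℚ_[p]) : ℚ :=
  ((clearDenom x).appr (-x.valuation).toNat : ℚ) / (p : ℚ) ^ (-x.valuation).toNat

/-- The standard additive character `Ψ(x) = exp(2πi {x}_p)` of `ℚ_[p]`. -/
def stdChar {p : ℕ} [Fact p.Prime] (x : ℚ_[p]) : ℂ :=
  Complex.exp (2 * Real.pi * Complex.I * (fracPart x : ℂ))

/-- The fundamental solution
`Z(x, t) = ∫ Ψ(x · ξ) exp(-a t ‖ξ‖ ^ α) d^n ξ` (meaningful for `t > 0`); the norm of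
`Fin n → ℚ_[p]` is the maximum norm `‖ξ‖_p`. -/
def heatKernel {p : ℕ} [Fact p.Prime] {n : ℕ} (a α : ℝ) (x : Fin n → ℚ_[p]) (t : ℝ) : ℂ :=
  ∫ ξ : Fin n → ℚ_[p],
    stdChar (∑ i, x i * ξ i) * ((Real.exp (-(a * t * ‖ξ‖ ^ α)) : ℝ) : ℂ)

/-- The integrand of the Taibleson operator: `‖y‖ ^ (-α-n) (φ(x - y) - φ(x))`. -/
def taiblesonIntegrand {p : ℕ} [Fact p.Prime] {n : ℕ} (α : ℝ) (φ : (Fin n → ℚ_[p]) → ℂ)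
    (x y : Fin n → ℚ_[p]) : ℂ :=
  ((‖y‖ ^ (-α - (n : ℝ)) : ℝ) : ℂ) * (φ (x - y) - φ x)

/-- The Taibleson operator
`(D_T^α φ)(x) = (1 - p^α) / (1 - p^(-α-n)) ∫ ‖y‖ ^ (-α-n) (φ(x - y) - φ(x)) d^n y`,
in the form in which it acts on functions that need be neither bounded nor integrable. -/
def taibleson {p : ℕ} [Fact p.Prime] {n : ℕ} (α : ℝ) (φ : (Fin n → ℚ_[p]) → ℂ)
    (x : Fin n → ℚ_[p]) : ℂ :=
  (((1 - (p : ℝ) ^ α) / (1 - (p : ℝ) ^ (-α - (n : ℝ))) : ℝ) : ℂ) *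
    ∫ y : Fin n → ℚ_[p], taiblesonIntegrand α φ x y

/-- The space `𝔐_λ`: locally constant functions with `|φ(x)| ≤ C (1 + ‖x‖ ^ λ)`. -/
def MemM {p : ℕ} [Fact p.Prime] {n : ℕ} (lam : ℝ) (φ : (Fin n → ℚ_[p]) → ℂ) : Prop :=
  IsLocallyConstant φ ∧ ∃ C : ℝ, ∀ x, ‖φ x‖ ≤ C * (1 + ‖x‖ ^ lam)

/-- `φ` is constant on the ball with centre `x` and radius `p ^ l`. -/
def ConstAt {p : ℕ} [Fact p.Prime] {n : ℕ} (l : ℤ) (φ : (Fin n → ℚ_[p]) → ℂ)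
    (x : Fin n → ℚ_[p]) : Prop :=
  ∀ y : Fin n → ℚ_[p], ‖y‖ ≤ (p : ℝ) ^ l → φ (x + y) = φ x

/-- `g(·, t) ∈ 𝔐_λ` uniformly with respect to `t ∈ S`: neither the constant `C` of the growth
bound nor the exponents `l(x)` of local constancy depend on `t`. -/
def UniformMemM {p : ℕ} [Fact p.Prime] {n : ℕ} (lam : ℝ) (S : Set ℝ)
    (g : (Fin n → ℚ_[p]) → ℝ → ℂ) : Prop :=
  (∀ x, ∃ l : ℤ, ∀ t ∈ S, ConstAt l (fun z => g z t) x) ∧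
    ∃ C : ℝ, ∀ t ∈ S, ∀ x, ‖g x t‖ ≤ C * (1 + ‖x‖ ^ lam)

/-- `u` solves `∂u/∂t + a D_T^α u = f` on `ℚ_p^n × (0, T]`, `u(x, 0) = φ(x)`: the integral that
defines `D_T^α u` converges, the derivative exists (one-sided at `t = T`), and the equations
hold. -/
def IsCauchySolution {p : ℕ} [Fact p.Prime] {n : ℕ} (a α T : ℝ)
    (f : (Fin n → ℚ_[p]) → ℝ → ℂ) (φ : (Fin n → ℚ_[p]) → ℂ)
    (u : (Fin n → ℚ_[p]) → ℝ → ℂ) : Prop :=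
  (∀ x, ∀ t ∈ Ioc 0 T,
    Integrable (taiblesonIntegrand α (fun z => u z t) x) ∧
    ∃ v : ℂ, HasDerivWithinAt (fun s => u x s) v (Icc 0 T) t ∧
      v + (a : ℂ) * taibleson α (fun z => u z t) x = f x t) ∧
  ∀ x, u x 0 = φ x

end

end PadicHeat

namespace PadicHeat

noncomputable section

variable {p : ℕ} [Fact p.Prime] {n : ℕ}

/-! Write Q = p^α, let A_j g(x) be the average of g over the ball of radius p^j about x (`ballAvg`),
and call A_j g - g its deviation (`avgDev`). Both kernels of the problem are superpositions of
indicators of balls, and the Fourier transform of the indicator of a ball is a multiple of the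
indicator of the dual ball. With w_j(t) = exp(-atQ^(-j)) - exp(-atQ^(-(j-1))) this gives Z(·,t) * g
= ∑ w_j(t) A_j g (`hasSum_heatKernel`, `integrable_and_hasSum_heatKernel_mul`), where for t > 0 the
weights are nonnegative, have sum 1 and are O(Q^(-j)). Likewise D_T^α g = ∑ (Q^(-j) - Q^(-(j-1)))
(A_j g - g) (`integrable_and_hasSum_taibleson`). At x the deviations vanish for j ≤ l(x), by local
constancy, and are O(p^(λj)) above; so λ < α makes the series converge.

Since A_i A_j = A_max(i,j) (`ballAvg_ballAvg`), the deviations of the heat flow of g are finite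
combinations of those of g (`avgDev_heatFlow`), and time enters only through the scalar equations y'
= b - aQ^(-m) y (`mode`). The Duhamel formula becomes φ + ∫ f plus a series of differences of modes
(`heatSolution_eq_series`), which can be differentiated termwise. The derivative is f minus a times
a series that summation by parts identifies with D_T^α u (`hasSum_unique_of_summation_by_parts`,
`hasDerivAt_heatSolution`).

Exchanging averages with sums and time integrals needs no domination: for all functions with the
same radii of constancy, a ball average is one fixed finite combination of point values
(`exists_ballAvg_eq_sum`). These radii pass from the data to the solution, which also gives joint
continuity and the invariance statement. -/

theorem one_lt_prime_cast (p : ℕ) [Fact p.Prime] : (1 : ℝ) < p := by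
  exact_mod_cast (Fact.out : p.Prime).one_lt

theorem prime_cast_pos (p : ℕ) [Fact p.Prime] : (0 : ℝ) < p :=
  zero_lt_one.trans (one_lt_prime_cast p)

/-! ### Haar measure of balls in `ℚ_[p]` -/

instance : (volume : Measure ℚ_[p]).IsAddHaarMeasure :=
  inferInstanceAs (Measure.addHaarMeasure (unitBall p)).IsAddHaarMeasure

/-- Multiplication by p^(k+1) carries the ball onto ℤ_p, where the residue mod p selects the piece.
-/
theorem closedBall_zpow_eq_iUnion (k : ℤ) :
    Metric.closedBall (0 : ℚ_[p]) ((p : ℝ) ^ (k + 1)) =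
      ⋃ i : Fin p, Metric.closedBall ((i : ℕ) * (p : ℚ_[p]) ^ (-(k + 1))) ((p : ℝ) ^ k) := by
  have hp := prime_cast_pos p
  have hp0 : (p : ℚ_[p]) ≠ 0 := by exact_mod_cast (Fact.out : p.Prime).ne_zero
  have key : ∀ x : ℚ_[p], ∀ i : ℕ, ‖x - i * (p : ℚ_[p]) ^ (-(k + 1))‖ =
      ‖x * (p : ℚ_[p]) ^ (k + 1) - i‖ * (p : ℝ) ^ (k + 1) := by
    intro x i
    have : x - i * (p : ℚ_[p]) ^ (-(k + 1)) =
        (x * (p : ℚ_[p]) ^ (k + 1) - i) * (p : ℚ_[p]) ^ (-(k + 1)) := by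
      rw [sub_mul, mul_assoc, ← zpow_add₀ hp0]; simp
    rw [this, norm_mul, Padic.norm_p_zpow, neg_neg]
  ext x
  simp only [mem_iUnion, Metric.mem_closedBall, dist_eq_norm, sub_zero]
  constructor
  · intro hx
    have hz : ‖x * (p : ℚ_[p]) ^ (k + 1)‖ ≤ 1 := by
      rw [norm_mul, Padic.norm_p_zpow, zpow_neg]
      exact mul_inv_le_one_of_le₀ hx (by positivity)
    obtain ⟨i, hi, h⟩ := PadicInt.exists_mem_range (p := p) ⟨_, hz⟩
    refine ⟨⟨i, hi⟩, ?_⟩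
    rw [key, zpow_add_one₀ hp.ne']
    rw [PadicInt.maximalIdeal_eq_span_p, ← pow_one (p : ℤ_[p]),
      ← PadicInt.norm_le_pow_iff_mem_span_pow] at h
    have h' : ‖x * (p : ℚ_[p]) ^ (k + 1) - i‖ ≤ (p : ℝ) ^ (-1 : ℤ) := by
      rw [PadicInt.norm_def] at h
      push_cast at h
      exact h
    calc _ ≤ (p : ℝ) ^ (-1 : ℤ) * ((p : ℝ) ^ k * p) := by gcongr
      _ = _ := by field_simp
  · rintro ⟨i, hi⟩
    have h1 : ‖((i : ℕ) : ℚ_[p]) * (p : ℚ_[p]) ^ (-(k + 1))‖ ≤ (p : ℝ) ^ (k + 1) := by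
      rw [norm_mul, Padic.norm_p_zpow, neg_neg]
      exact mul_le_of_le_one_left (by positivity) (by exact_mod_cast Padic.norm_int_le_one (i : ℤ))
    have h2 : (p : ℝ) ^ k ≤ (p : ℝ) ^ (k + 1) :=
      zpow_le_zpow_right₀ (one_lt_prime_cast p).le (by lia)
    have := IsUltrametricDist.norm_add_le_max (x - (i : ℕ) * (p : ℚ_[p]) ^ (-(k + 1)))
      ((i : ℕ) * (p : ℚ_[p]) ^ (-(k + 1)))
    rw [sub_add_cancel] at this
    exact this.trans (max_le (hi.trans h2) h1)

/-- The p pieces are translates of one ball. They are disjoint because two of them could only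
coincide if p divided the difference of two distinct digits below p. -/
theorem volume_closedBall_succ (k : ℤ) :
    volume (Metric.closedBall (0 : ℚ_[p]) ((p : ℝ) ^ (k + 1))) =
      p * volume (Metric.closedBall (0 : ℚ_[p]) ((p : ℝ) ^ k)) := by
  have hp := prime_cast_pos p
  rw [closedBall_zpow_eq_iUnion, measure_iUnion]
  · have : ∀ c : ℚ_[p], volume (Metric.closedBall c ((p : ℝ) ^ k)) =
        volume (Metric.closedBall (0 : ℚ_[p]) ((p : ℝ) ^ k)) := by
      intro c
      have := measure_preimage_add_right (volume : Measure ℚ_[p]) (-c)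
        (Metric.closedBall (0 : ℚ_[p]) ((p : ℝ) ^ k))
      rw [← this]
      congr 1
      ext x
      simp [dist_eq_norm, sub_eq_add_neg]
    simp [this]
  · intro i j hij
    rcases IsUltrametricDist.closedBall_eq_or_disjoint
      (((i : ℕ) : ℚ_[p]) * (p : ℚ_[p]) ^ (-(k + 1))) (((j : ℕ) : ℚ_[p]) * (p : ℚ_[p]) ^ (-(k + 1)))
      ((p : ℝ) ^ k) with h | h
    · exfalso
      have hm : ((j : ℕ) : ℚ_[p]) * (p : ℚ_[p]) ^ (-(k + 1)) ∈
          Metric.closedBall (((i : ℕ) : ℚ_[p]) * (p : ℚ_[p]) ^ (-(k + 1))) ((p : ℝ) ^ k) := by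
        rw [h]; exact Metric.mem_closedBall_self (by positivity)
      rw [Metric.mem_closedBall, dist_eq_norm, ← sub_mul, norm_mul, Padic.norm_p_zpow, neg_neg,
        zpow_add_one₀ hp.ne'] at hm
      have hm' : ‖(((((j : ℕ) : ℤ) - ((i : ℕ) : ℤ) : ℤ)) : ℚ_[p])‖ ≤ (p : ℝ) ^ (-(1 : ℕ) : ℤ) := by
        have h3 : (0 : ℝ) < (p : ℝ) ^ k := by positivity
        have h4 : ‖(((((j : ℕ) : ℤ) - ((i : ℕ) : ℤ) : ℤ)) : ℚ_[p])‖ * p ≤ 1 := by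
          push_cast
          by_contra! hc
          have := mul_lt_mul_of_pos_left hc h3
          nlinarith
        simp only [Nat.cast_one, zpow_neg, zpow_one]
        rwa [← one_div, le_div_iff₀ hp]
      rw [Padic.norm_int_le_pow_iff_dvd, pow_one] at hm'
      have hi := i.2
      have hj := j.2
      apply hij
      ext
      by_contra hne
      have := Int.le_of_dvd (a := (p : ℤ)) (b := |((j : ℕ) : ℤ) - ((i : ℕ) : ℤ)|)
        (by rw [abs_pos]; lia) ((dvd_abs _ _).2 hm')
      rw [le_abs] at this
      omega
    · exact h
  · intro i
    exact Metric.isClosed_closedBall.measurableSet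

theorem volume_closedBall_padic (k : ℤ) :
    volume (Metric.closedBall (0 : ℚ_[p]) ((p : ℝ) ^ k)) = (p : ENNReal) ^ k := by
  have hp0 : (p : ENNReal) ≠ 0 := by exact_mod_cast (Fact.out : p.Prime).ne_zero
  have hpt : (p : ENNReal) ≠ ⊤ := ENNReal.natCast_ne_top p
  induction k using Int.induction_on with
  | zero =>
    simp only [zpow_zero]
    exact Measure.addHaarMeasure_self (K₀ := unitBall p)
  | succ k ih => rw [volume_closedBall_succ, ih, ENNReal.zpow_add hp0 hpt, zpow_one, mul_comm]
  | pred k ih =>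
    have h := volume_closedBall_succ (p := p) (-k - 1)
    rw [sub_add_cancel, ih] at h
    rw [sub_eq_add_neg, ENNReal.zpow_add hp0 hpt, h, zpow_neg_one, mul_comm, ← mul_assoc,
      ENNReal.inv_mul_cancel hp0 hpt, one_mul, ← sub_eq_add_neg]

/-! ### Balls in the n-dimensional space -/

/-- The closed ball of radius `p ^ j` centred at the origin. -/
def zball (p : ℕ) [Fact p.Prime] (n : ℕ) (j : ℤ) : Set (Fin n → ℚ_[p]) :=
  Metric.closedBall 0 ((p : ℝ) ^ j)

theorem mem_zball {j : ℤ} {y : Fin n → ℚ_[p]} : y ∈ zball p n j ↔ ‖y‖ ≤ (p : ℝ) ^ j := by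
  simp [zball]

theorem measurableSet_zball (j : ℤ) : MeasurableSet (zball p n j) :=
  Metric.isClosed_closedBall.measurableSet

theorem isCompact_zball (j : ℤ) : IsCompact (zball p n j) := isCompact_closedBall _ _

theorem zball_mono {i j : ℤ} (h : i ≤ j) : zball p n i ⊆ zball p n j :=
  Metric.closedBall_subset_closedBall (zpow_le_zpow_right₀ (one_lt_prime_cast p).le h)

theorem add_mem_zball {j : ℤ} {x y : Fin n → ℚ_[p]} (hx : x ∈ zball p n j)
    (hy : y ∈ zball p n j) : x + y ∈ zball p n j := by
  rw [mem_zball] at *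
  exact (IsUltrametricDist.norm_add_le_max x y).trans (max_le hx hy)

theorem neg_mem_zball {j : ℤ} {x : Fin n → ℚ_[p]} (hx : x ∈ zball p n j) :
    -x ∈ zball p n j := by
  rw [mem_zball] at *; rwa [norm_neg]

theorem sub_mem_zball {j : ℤ} {x y : Fin n → ℚ_[p]} (hx : x ∈ zball p n j)
    (hy : y ∈ zball p n j) : x - y ∈ zball p n j := by
  rw [sub_eq_add_neg]; exact add_mem_zball hx (neg_mem_zball hy)

theorem zero_mem_zball (j : ℤ) : (0 : Fin n → ℚ_[p]) ∈ zball p n j := by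
  have := prime_cast_pos p
  rw [mem_zball, norm_zero]; positivity

theorem volume_zball (j : ℤ) : volume (zball p n j) = ENNReal.ofReal (((p : ℝ) ^ n) ^ j) := by
  have hp := prime_cast_pos p
  rw [zball, closedBall_pi _ (by positivity), volume_pi_pi]
  simp only [Pi.zero_apply, volume_closedBall_padic, Finset.prod_const, Finset.card_univ,
    Fintype.card_fin]
  rw [← zpow_natCast (p : ℝ), ← zpow_mul, mul_comm, zpow_mul, zpow_natCast,
    ENNReal.ofReal_pow (by positivity)]
  congr 1
  rw [← ENNReal.ofReal_natCast]
  cases j with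
  | ofNat k => simp [ENNReal.ofReal_pow hp.le]
  | negSucc k =>
    rw [zpow_negSucc, zpow_negSucc, ENNReal.ofReal_inv_of_pos (by positivity),
      ENNReal.ofReal_pow hp.le]

theorem measureReal_zball (j : ℤ) : volume.real (zball p n j) = ((p : ℝ) ^ n) ^ j := by
  have hp := prime_cast_pos p
  rw [Measure.real, volume_zball, ENNReal.toReal_ofReal (by positivity)]

theorem exists_norm_eq_zpow {y : Fin n → ℚ_[p]} (hy : y ≠ 0) : ∃ m : ℤ, ‖y‖ = (p : ℝ) ^ m := by
  obtain ⟨i0, -⟩ := Function.ne_iff.1 hy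
  have : Nonempty (Fin n) := ⟨i0⟩
  obtain ⟨i, hi⟩ := Finite.exists_max fun i => ‖y i‖
  have h : ‖y‖ = ‖y i‖ :=
    le_antisymm ((pi_norm_le_iff_of_nonneg (norm_nonneg _)).2 hi) (norm_le_pi_norm y i)
  have hyi : y i ≠ 0 := by
    intro h0
    rw [h0, norm_zero, norm_eq_zero] at h
    exact hy h
  exact ⟨_, h.trans (Padic.norm_eq_zpow_neg_valuation hyi)⟩

/-! ### The additive character and the Fourier transform of a ball -/

theorem norm_sub_le_max_padic (x y : ℚ_[p]) : ‖x - y‖ ≤ max ‖x‖ ‖y‖ := by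
  rw [sub_eq_add_neg, ← norm_neg y]
  exact IsUltrametricDist.norm_add_le_max _ _

theorem fracPart_eq_natCast_div (x : ℚ_[p]) : ∃ N M : ℕ, fracPart x = (N : ℚ) / (p : ℚ) ^ M :=
  ⟨_, _, rfl⟩

theorem norm_sub_fracPart_le_one (x : ℚ_[p]) : ‖x - (fracPart x : ℚ_[p])‖ ≤ 1 := by
  have hp := prime_cast_pos p
  have hp0 : (p : ℚ_[p]) ≠ 0 := by exact_mod_cast (Fact.out : p.Prime).ne_zero
  set m := (-x.valuation).toNat with hm
  have h := PadicInt.appr_spec m (clearDenom x)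
  rw [← PadicInt.norm_le_pow_iff_mem_span_pow, PadicInt.norm_def] at h
  have h' : ‖x * (p : ℚ_[p]) ^ m - ((clearDenom x).appr m : ℚ_[p])‖ ≤ (p : ℝ) ^ (-(m : ℤ)) := by
    push_cast at h
    exact h
  have e : x - (fracPart x : ℚ_[p]) =
      (x * (p : ℚ_[p]) ^ m - ((clearDenom x).appr m : ℚ_[p])) * ((p : ℚ_[p]) ^ m)⁻¹ := by
    have : (fracPart x : ℚ_[p]) = ((clearDenom x).appr m : ℚ_[p]) / (p : ℚ_[p]) ^ m := by
      rw [fracPart, ← hm]; push_cast; rfl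
    rw [this]; field_simp
  rw [e, norm_mul, norm_inv, norm_pow, Padic.norm_p, inv_pow, inv_inv]
  calc _ ≤ (p : ℝ) ^ (-(m : ℤ)) * (p : ℝ) ^ m := by gcongr
    _ = 1 := by rw [zpow_neg, zpow_natCast, inv_mul_cancel₀ (by positivity)]

/-- This is ℤ[1/p] ∩ ℤ_p = ℤ. It turns p-adic estimates on fractional parts into the integrality
that the complex exponential requires. -/
theorem exists_intCast_eq_of_norm_le_one {q : ℚ} {N : ℤ} {M : ℕ} (hq : q = N / (p : ℚ) ^ M)
    (h : ‖(q : ℚ_[p])‖ ≤ 1) : ∃ k : ℤ, q = k := by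
  have hp := prime_cast_pos p
  have hp0 : (p : ℚ) ≠ 0 := by exact_mod_cast (Fact.out : p.Prime).ne_zero
  have hN : (N : ℚ) = q * (p : ℚ) ^ M := by rw [hq]; field_simp
  have hd : (p ^ M : ℤ) ∣ N := by
    rw [← Padic.norm_int_le_pow_iff_dvd]
    have : (N : ℚ_[p]) = (q : ℚ_[p]) * (p : ℚ_[p]) ^ M := by exact_mod_cast congrArg (Rat.cast : ℚ → ℚ_[p]) hN
    rw [this, norm_mul, norm_pow, Padic.norm_p, inv_pow, zpow_neg, zpow_natCast]
    exact mul_le_of_le_one_left (by positivity) h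
  obtain ⟨k, hk⟩ := hd
  refine ⟨k, ?_⟩
  rw [hq, hk]; push_cast; field_simp

theorem stdChar_eq_one_iff_exists_int (x : ℚ_[p]) :
    stdChar x = 1 ↔ ∃ k : ℤ, fracPart x = k := by
  rw [stdChar, Complex.exp_eq_one_iff]
  have h0 : (2 * Real.pi * Complex.I : ℂ) ≠ 0 := Complex.two_pi_I_ne_zero
  refine exists_congr fun k => ?_
  rw [mul_comm (k : ℂ), mul_right_inj' h0]
  exact_mod_cast Iff.rfl

theorem stdChar_eq_one_iff (x : ℚ_[p]) : stdChar x = 1 ↔ ‖x‖ ≤ 1 := by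
  rw [stdChar_eq_one_iff_exists_int]
  have hs := norm_sub_fracPart_le_one x
  constructor
  · rintro ⟨k, hk⟩
    have h1 : ‖(fracPart x : ℚ_[p])‖ ≤ 1 := by
      rw [hk]; exact_mod_cast Padic.norm_int_le_one k
    have := IsUltrametricDist.norm_add_le_max (x - (fracPart x : ℚ_[p])) (fracPart x : ℚ_[p])
    rw [sub_add_cancel] at this
    exact this.trans (max_le hs h1)
  · intro hx
    obtain ⟨N, M, h⟩ := fracPart_eq_natCast_div x
    refine exists_intCast_eq_of_norm_le_one (p := p) (N := N) (M := M) (by rw [h, Int.cast_natCast]) ?_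
    have := norm_sub_le_max_padic x (x - (fracPart x : ℚ_[p]))
    rw [sub_sub_cancel] at this
    exact this.trans (max_le hx hs)

/-- The defect of additivity of `fracPart` has a power of p as denominator and, since x - {x} is
always in ℤ_p, is a p-adic integer. Hence it is an integer. -/
theorem stdChar_add (x y : ℚ_[p]) : stdChar (x + y) = stdChar x * stdChar y := by
  have hp0 : (p : ℚ) ≠ 0 := by exact_mod_cast (Fact.out : p.Prime).ne_zero
  have key : ∃ k : ℤ, fracPart (x + y) - fracPart x - fracPart y = k := by
    obtain ⟨N1, M1, h1⟩ := fracPart_eq_natCast_div (x + y)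
    obtain ⟨N2, M2, h2⟩ := fracPart_eq_natCast_div x
    obtain ⟨N3, M3, h3⟩ := fracPart_eq_natCast_div y
    refine exists_intCast_eq_of_norm_le_one (p := p)
      (N := N1 * p ^ (M2 + M3) - N2 * p ^ (M1 + M3) - N3 * p ^ (M1 + M2)) (M := M1 + M2 + M3) ?_ ?_
    · rw [h1, h2, h3]; push_cast; field_simp; ring
    · have e : ((fracPart (x + y) - fracPart x - fracPart y : ℚ) : ℚ_[p]) =
          (x - fracPart x) + (y - fracPart y) - (x + y - fracPart (x + y)) := by push_cast; ring
      rw [e]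
      refine (norm_sub_le_max_padic _ _).trans (max_le ?_ (norm_sub_fracPart_le_one _))
      exact (IsUltrametricDist.norm_add_le_max _ _).trans
        (max_le (norm_sub_fracPart_le_one _) (norm_sub_fracPart_le_one _))
  obtain ⟨k, hk⟩ := key
  have h : (fracPart (x + y) : ℂ) = fracPart x + fracPart y + k := by
    have : fracPart (x + y) = fracPart x + fracPart y + k := by linarith
    rw [this]; push_cast; ring
  rw [stdChar, stdChar, stdChar, h, ← Complex.exp_add, mul_add, Complex.exp_add,
    mul_comm _ (k : ℂ), Complex.exp_int_mul_two_pi_mul_I, mul_one, mul_add]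

theorem norm_stdChar (x : ℚ_[p]) : ‖stdChar x‖ = 1 := by
  have : (2 * Real.pi * Complex.I * (fracPart x : ℂ)) =
      ((2 * Real.pi * (fracPart x : ℝ) : ℝ) : ℂ) * Complex.I := by push_cast; ring
  rw [stdChar, this, Complex.norm_exp_ofReal_mul_I]

theorem continuous_stdChar : Continuous (stdChar : ℚ_[p] → ℂ) := by
  refine IsLocallyConstant.continuous ((IsLocallyConstant.iff_eventually_eq _).2 fun x => ?_)
  filter_upwards [Metric.closedBall_mem_nhds x one_pos] with y hy
  rw [Metric.mem_closedBall, dist_eq_norm, ← stdChar_eq_one_iff] at hy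
  rw [← sub_add_cancel y x, stdChar_add, hy, one_mul]

theorem continuous_stdChar_sum (x : Fin n → ℚ_[p]) :
    Continuous fun ξ : Fin n → ℚ_[p] => stdChar (∑ i, x i * ξ i) :=
  continuous_stdChar.comp (by fun_prop)

theorem norm_sum_mul_le (x ξ : Fin n → ℚ_[p]) : ‖∑ i, x i * ξ i‖ ≤ ‖x‖ * ‖ξ‖ := by
  refine IsUltrametricDist.norm_sum_le_of_forall_le_of_nonneg (by positivity) fun i _ => ?_
  rw [norm_mul]
  exact mul_le_mul (norm_le_pi_norm x i) (norm_le_pi_norm ξ i) (norm_nonneg _) (norm_nonneg _)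

/-- Orthogonality of characters: on the ball, a subgroup, the character is either trivial or takes a
value other than 1 at some η, and translation by η then forces the integral to vanish. -/
theorem setIntegral_stdChar (x : Fin n → ℚ_[p]) (j : ℤ) :
    ∫ ξ in zball p n (-j), stdChar (∑ i, x i * ξ i) =
      (zball p n j).indicator (fun _ => ((((p : ℝ) ^ n) ^ (-j) : ℝ) : ℂ)) x := by
  have hp := prime_cast_pos p
  by_cases hx : x ∈ zball p n j
  · rw [indicator_of_mem hx, setIntegral_congr_fun (measurableSet_zball _) (g := fun _ => (1 : ℂ)),
      setIntegral_const, measureReal_zball]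
    · simp
    · intro ξ hξ
      rw [mem_zball] at hx hξ
      change stdChar _ = 1
      rw [stdChar_eq_one_iff]
      refine (norm_sum_mul_le x ξ).trans ?_
      calc _ ≤ (p : ℝ) ^ j * (p : ℝ) ^ (-j) := by gcongr
        _ = 1 := by rw [← zpow_add₀ hp.ne']; simp
  · rw [indicator_of_notMem hx]
    have : ∃ i, (p : ℝ) ^ j < ‖x i‖ := by
      by_contra! hc
      exact hx (mem_zball.2 ((pi_norm_le_iff_of_nonneg (by positivity)).2 hc))
    obtain ⟨i, hi⟩ := this
    -- This η has norm p^(-j), and x · η = x_i p^j has norm above 1, where the character is not 1.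
    set η : Fin n → ℚ_[p] := Pi.single i ((p : ℚ_[p]) ^ j) with hη
    have hηm : η ∈ zball p n (-j) := by
      rw [mem_zball, hη, pi_norm_le_iff_of_nonneg (by positivity)]
      intro k
      rcases eq_or_ne k i with rfl | hk
      · simp
      · rw [Pi.single_eq_of_ne hk, norm_zero]; positivity
    have hc : stdChar (∑ k, x k * η k) ≠ 1 := by
      rw [Ne, stdChar_eq_one_iff, hη]
      simp only [Pi.single_apply, mul_ite, mul_zero, Finset.sum_ite_eq', Finset.mem_univ, if_true,
        norm_mul, Padic.norm_p_zpow, not_le]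
      calc (1 : ℝ) = (p : ℝ) ^ j * (p : ℝ) ^ (-j) := by rw [← zpow_add₀ hp.ne']; simp
        _ < _ := by gcongr
    set I := ∫ ξ in zball p n (-j), stdChar (∑ i, x i * ξ i) with hI
    have e : I = stdChar (∑ k, x k * η k) * I := by
      rw [hI, ← integral_const_mul, ← integral_indicator (measurableSet_zball _),
        ← integral_indicator (measurableSet_zball _),
        ← integral_add_left_eq_self (μ := volume) _ η]
      refine integral_congr_ae (Filter.Eventually.of_forall fun ξ => ?_)
      change indicator _ _ (η + ξ) = indicator _ _ ξ
      by_cases hξ : ξ ∈ zball p n (-j)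
      · rw [indicator_of_mem hξ, indicator_of_mem (add_mem_zball hηm hξ), ← stdChar_add]
        simp [mul_add, Finset.sum_add_distrib]
      · rw [indicator_of_notMem hξ, indicator_of_notMem]
        intro hh
        apply hξ
        have := sub_mem_zball hh hηm
        rwa [add_sub_cancel_left] at this
    have : (1 - stdChar (∑ k, x k * η k)) * I = 0 := by rw [sub_mul, one_mul, ← e, sub_self]
    rcases mul_eq_zero.1 this with h | h
    · exact absurd (sub_eq_zero.1 h).symm hc
    · exact h

/-! ### Integrability of series, telescoping and geometric sums over `ℤ` -/

open Filter Topology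

theorem integrable_of_hasSum {β : Type*} [MeasurableSpace β] {m : Measure β} {ι : Type*}
    [Countable ι] {F : ι → β → ℂ} {f : β → ℂ} (hF : ∀ i, Integrable (F i) m)
    (hs : Summable fun i => ∫ x, ‖F i x‖ ∂m) (hf : ∀ᵐ x ∂m, HasSum (fun i => F i x) (f x)) :
    Integrable f m := by
  refine ⟨aestronglyMeasurable_of_tendsto_ae (u := (atTop : Filter (Finset ι)))
    (f := fun s x => ∑ i ∈ s, F i x) ?_ hf, ?_⟩
  · exact fun s => Finset.aestronglyMeasurable_fun_sum s fun i _ => (hF i).1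
  · rw [HasFiniteIntegral]
    calc ∫⁻ x, ‖f x‖ₑ ∂m ≤ ∫⁻ x, ∑' i, ‖F i x‖ₑ ∂m := by
          refine lintegral_mono_ae (hf.mono fun x hx => ?_)
          rw [← hx.tsum_eq]
          exact enorm_tsum_le_tsum_enorm
      _ = ∑' i, ENNReal.ofReal (∫ x, ‖F i x‖ ∂m) := by
          rw [lintegral_tsum fun i => (hF i).1.enorm]
          exact tsum_congr fun i => (ofReal_integral_norm_eq_lintegral_enorm (hF i)).symm
      _ < ⊤ := by
          rw [← ENNReal.ofReal_tsum_of_nonneg (fun i => by positivity) hs]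
          exact ENNReal.ofReal_lt_top

theorem hasSum_Iic_sub {F : ℤ → ℝ} (hF : Monotone F) {A : ℝ} (hA : Tendsto F atBot (𝓝 A))
    (M : ℤ) : HasSum (fun j => if j ≤ M then F j - F (j - 1) else 0) (F M - A) := by
  have hinj : Function.Injective fun k : ℕ => M - (k : ℤ) := fun a b h => by simpa using h
  rw [← hinj.hasSum_iff, hasSum_iff_tendsto_nat_of_nonneg]
  · have : ∀ N : ℕ, ∑ i ∈ Finset.range N, ((fun j => if j ≤ M then F j - F (j - 1) else 0) ∘
        fun k : ℕ => M - (k : ℤ)) i = F M - F (M - N) := by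
      intro N
      induction N with
      | zero => simp
      | succ N ih =>
        rw [Finset.sum_range_succ, ih]
        simp only [Function.comp_apply, if_pos (show M - (N : ℤ) ≤ M by lia)]
        push_cast
        rw [← sub_sub]; ring
    simp only [this]
    refine tendsto_const_nhds.sub (hA.comp ?_)
    exact tendsto_atBot_add_const_left _ _ (tendsto_neg_atTop_atBot.comp tendsto_natCast_atTop_atTop)
  · intro k
    simp only [Function.comp_apply]
    split_ifs
    · exact sub_nonneg.2 (hF (by lia))
    · rfl
  · intro j hj
    rw [if_neg]
    intro h
    exact hj ⟨(M - j).toNat, by simp only; lia⟩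

theorem hasSum_Ioi_sub {F : ℤ → ℝ} (hF : Monotone F) {B : ℝ} (hB : Tendsto F atTop (𝓝 B))
    (M : ℤ) : HasSum (fun j => if M < j then F j - F (j - 1) else 0) (B - F M) := by
  have h := hasSum_Iic_sub (F := fun j => -F (-j)) (fun a b hab => neg_le_neg (hF (neg_le_neg hab)))
    (A := -B) (hB.comp tendsto_neg_atBot_atTop).neg (-M)
  rw [neg_neg, sub_neg_eq_add, add_comm, ← sub_eq_add_neg] at h
  -- The reflection is j ↦ 1 - j, not j ↦ -j: the difference of -F(-·) at index i is F(1 - i) -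
  -- F(-i).
  have e2 : (fun j => if M < j then F j - F (j - 1) else 0) =
      (fun j : ℤ => if j ≤ -M then -F (-j) - -F (-(j - 1)) else 0) ∘ (Equiv.subLeft (1 : ℤ)) := by
    funext j
    simp only [Function.comp_apply, Equiv.subLeft_apply]
    rw [show -(1 - j) = j - 1 by ring, show -(1 - j - 1) = j by ring]
    by_cases hj : M < j
    · rw [if_pos hj, if_pos (by lia)]; ring
    · rw [if_neg hj, if_neg (by lia)]
  rw [e2]
  exact (Equiv.hasSum_iff (Equiv.subLeft (1 : ℤ))).2 h

theorem tendsto_zpow_int_atTop {r : ℝ} (h0 : 0 ≤ r) (h1 : r < 1) :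
    Tendsto (fun j : ℤ => r ^ j) atTop (𝓝 0) := by
  have ht : Tendsto Int.toNat atTop atTop :=
    tendsto_atTop.2 fun b => (eventually_ge_atTop (b : ℤ)).mono fun j hj => by lia
  refine ((tendsto_pow_atTop_nhds_zero_of_lt_one h0 h1).comp ht).congr' ?_
  filter_upwards [eventually_ge_atTop (0 : ℤ)] with j hj
  rw [Function.comp_apply, ← zpow_natCast, Int.toNat_of_nonneg hj]

/-- Telescoping: the increments of -r^(j+1) are (1 - r) r^j. -/
theorem summable_Ioi_zpow {r : ℝ} (h0 : 0 < r) (h1 : r < 1) (l : ℤ) :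
    Summable fun j : ℤ => if l < j then r ^ j else 0 := by
  have hF : Monotone fun j : ℤ => -r ^ (j + 1) := fun a b hab =>
    neg_le_neg (zpow_le_zpow_right_of_le_one₀ h0 h1.le (by lia))
  have hB : Tendsto (fun j : ℤ => -r ^ (j + 1)) atTop (𝓝 (-0)) := by
    refine Tendsto.neg ?_
    exact (tendsto_zpow_int_atTop h0.le h1).comp (tendsto_atTop_add_const_right _ _ tendsto_id)
  have := ((hasSum_Ioi_sub hF hB l).summable).mul_left (1 - r)⁻¹
  refine this.congr fun j => ?_
  have : 1 - r ≠ 0 := by linarith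
  split_ifs
  · rw [sub_add_cancel, zpow_add_one₀ h0.ne']; field_simp; ring
  · simp

theorem summable_Iio_zpow {r : ℝ} (h1 : 1 < r) (l : ℤ) :
    Summable fun j : ℤ => if j < l then r ^ j else 0 := by
  have h0 : 0 < r := by linarith
  rw [← Equiv.summable_iff (Equiv.neg ℤ)]
  refine (summable_Ioi_zpow (inv_pos.2 h0) (inv_lt_one_of_one_lt₀ h1) (-l)).congr fun j => ?_
  simp only [Function.comp_apply, Equiv.neg_apply, inv_zpow', neg_lt]

/-! ### Weights of the heat flow -/

/-- The factor by which the heat flow damps the difference of consecutive ball averages. -/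
def decay (a Q : ℝ) (j : ℤ) (t : ℝ) : ℝ := Real.exp (-(a * t * Q ^ (-j)))

/-- The mass that the heat flow at time `t` gives to the average over the ball of
radius `p ^ j`. -/
def weight (a Q : ℝ) (j : ℤ) (t : ℝ) : ℝ := decay a Q j t - decay a Q (j - 1) t

section weights

variable {a Q : ℝ} {j : ℤ} {t : ℝ}

theorem decay_pos : 0 < decay a Q j t := Real.exp_pos _

theorem decay_zero_time : decay a Q j 0 = 1 := by simp [decay]

theorem weight_zero_time : weight a Q j 0 = 0 := by simp [weight, decay_zero_time]

theorem continuous_decay : Continuous (decay a Q j) := by unfold decay; fun_prop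

theorem continuous_weight : Continuous (weight a Q j) := by
  exact continuous_decay.sub continuous_decay

theorem decay_le_one (ha : 0 ≤ a) (hQ : 0 ≤ Q) (ht : 0 ≤ t) : decay a Q j t ≤ 1 := by
  rw [decay, Real.exp_le_one_iff, neg_nonpos]; positivity

theorem decay_monotone (ha : 0 ≤ a) (hQ : 1 < Q) (ht : 0 ≤ t) :
    Monotone fun j => decay a Q j t := by
  intro i j hij
  refine Real.exp_le_exp.2 (neg_le_neg (mul_le_mul_of_nonneg_left ?_ (by positivity)))
  exact zpow_le_zpow_right₀ hQ.le (by lia)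

theorem weight_nonneg (ha : 0 ≤ a) (hQ : 1 < Q) (ht : 0 ≤ t) : 0 ≤ weight a Q j t :=
  sub_nonneg.2 (decay_monotone ha hQ ht (by lia))

theorem weight_le_decay : weight a Q j t ≤ decay a Q j t :=
  sub_le_self _ decay_pos.le

/-- From 1 - exp(-x) ≤ x. The factor Q^(-j) beats the growth p^(λj) of averages over large balls;
the factor t keeps the bound uniform on bounded time intervals. -/
theorem weight_le (ha : 0 ≤ a) (hQ : 1 < Q) (ht : 0 ≤ t) :
    weight a Q j t ≤ a * t * Q * Q ^ (-j) := by
  have h1 : decay a Q j t ≤ 1 := decay_le_one ha (by linarith) ht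
  have h2 := Real.add_one_le_exp (-(a * t * Q ^ (-(j - 1))))
  have h3 : Q ^ (-(j - 1)) = Q * Q ^ (-j) := by
    rw [neg_sub, sub_eq_add_neg, zpow_add₀ (by linarith), zpow_one]
  rw [h3] at h2
  rw [weight, decay, decay, h3] at *
  linarith

theorem tendsto_decay_atTop (hQ : 1 < Q) : Tendsto (fun j => decay a Q j t) atTop (𝓝 1) := by
  have h := tendsto_zpow_int_atTop (r := Q⁻¹) (by positivity) (inv_lt_one_of_one_lt₀ hQ)
  have h2 := ((h.const_mul (a * t)).neg).rexp
  simp only [mul_zero, neg_zero, Real.exp_zero] at h2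
  refine h2.congr fun j => ?_
  rw [decay, inv_zpow']

theorem tendsto_zpow_neg_atBot (hQ : 1 < Q) : Tendsto (fun j : ℤ => Q ^ (-j)) atBot atTop := by
  have h := tendsto_zpow_int_atTop (r := Q⁻¹) (by positivity) (inv_lt_one_of_one_lt₀ hQ)
  have h2 : Tendsto (fun j : ℤ => Q⁻¹ ^ j) atTop (𝓝[>] 0) :=
    tendsto_nhdsWithin_iff.2 ⟨h, Eventually.of_forall fun j => by
      simp only [mem_Ioi]; positivity⟩
  refine (h2.inv_tendsto_nhdsGT_zero.comp tendsto_neg_atBot_atTop).congr fun j => ?_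
  simp [inv_zpow']

theorem tendsto_decay_atBot (ha : 0 < a) (hQ : 1 < Q) (ht : 0 < t) :
    Tendsto (fun j => decay a Q j t) atBot (𝓝 0) :=
  Real.tendsto_exp_atBot.comp (tendsto_neg_atTop_atBot.comp
    ((tendsto_zpow_neg_atBot hQ).const_mul_atTop (by positivity)))

theorem hasSum_weight_Iic (ha : 0 < a) (hQ : 1 < Q) (ht : 0 < t) (M : ℤ) :
    HasSum (fun j => if j ≤ M then weight a Q j t else 0) (decay a Q M t) := by
  simpa [weight] using hasSum_Iic_sub (decay_monotone ha.le hQ ht.le) (tendsto_decay_atBot ha hQ ht) M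

theorem hasSum_weight_Ioi (ha : 0 ≤ a) (hQ : 1 < Q) (ht : 0 ≤ t) (M : ℤ) :
    HasSum (fun j => if M < j then weight a Q j t else 0) (1 - decay a Q M t) :=
  hasSum_Ioi_sub (decay_monotone ha hQ ht) (tendsto_decay_atTop hQ) M

theorem hasSum_weight (ha : 0 < a) (hQ : 1 < Q) (ht : 0 < t) :
    HasSum (fun j => weight a Q j t) 1 := by
  have h := (hasSum_weight_Iic ha hQ ht 0).add (hasSum_weight_Ioi ha.le hQ ht.le 0)
  rw [add_sub_cancel] at h
  refine h.congr_fun fun j => ?_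
  by_cases hj : j ≤ 0
  · rw [if_pos hj, if_neg (by lia), add_zero]
  · rw [if_neg hj, if_pos (by lia), zero_add]

/-- For j ≥ 1 the bound O(Q^(-j)) suffices. For j ≤ 0 the weight is smaller than any power: x^m / m!
≤ exp x gives a factor Q^(mj), and m is chosen with Q^m N > 1. -/
theorem summable_weight_mul_zpow (ha : 0 < a) (hQ : 1 < Q) (ht : 0 < t) {N : ℝ} (hN : 0 < N)
    (hNQ : Q⁻¹ * N < 1) : Summable fun j => weight a Q j t * N ^ j := by
  obtain ⟨m, hm⟩ := pow_unbounded_of_one_lt N⁻¹ hQ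
  have h1 : 1 < Q ^ m * N := by
    have := mul_lt_mul_of_pos_right hm hN
    rwa [inv_mul_cancel₀ hN.ne'] at this
  have hs := ((summable_Iio_zpow h1 1).mul_left ((m.factorial : ℝ) / (a * t) ^ m)).add
    ((summable_Ioi_zpow (r := Q⁻¹ * N) (by positivity) hNQ 0).mul_left (a * t * Q))
  refine Summable.of_nonneg_of_le (fun j => ?_) (fun j => ?_) hs
  · exact mul_nonneg (weight_nonneg ha.le hQ ht.le) (by positivity)
  · by_cases hj : j < 1
    · rw [if_pos hj, if_neg (by lia), mul_zero, add_zero]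
      have hx : 0 < a * t * Q ^ (-j) := by positivity
      have h2 := Real.pow_div_factorial_le_exp _ hx.le m
      have h3 : decay a Q j t ≤ m.factorial / (a * t * Q ^ (-j)) ^ m := by
        rw [decay, Real.exp_neg, ← inv_div]
        exact inv_anti₀ (by positivity) h2
      calc weight a Q j t * N ^ j ≤ m.factorial / (a * t * Q ^ (-j)) ^ m * N ^ j := by
            gcongr; exact weight_le_decay.trans h3
        _ = _ := by
            rw [mul_pow (a * t), mul_zpow, ← zpow_natCast (Q ^ (-j)), ← zpow_natCast Q m, ← zpow_mul,
              ← zpow_mul, neg_mul, zpow_neg, mul_comm j]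
            field_simp
    · rw [if_neg hj, if_pos (by lia), mul_zero, zero_add, mul_zpow, inv_zpow', ← mul_assoc]
      gcongr
      exact weight_le ha.le hQ ht.le

end weights

/-! ### Integration against superpositions of balls -/

section mixture

/-- Sum and integral are exchanged by absolute convergence. The expansion is required of the product
`K y * h y` only, since the Taibleson kernel has none at the origin. The map `σ` lets the Fourier
side run over the dual radii p^(-j). -/
theorem integrable_and_hasSum_integral_of_mixture {κ : ℤ → ℝ} (hκ : ∀ j, 0 ≤ κ j) {σ : ℤ → ℤ}
    {h K : (Fin n → ℚ_[p]) → ℂ} (hh : ∀ j, IntegrableOn h (zball p n j))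
    (hs : Summable fun j => κ j * ∫ y in zball p n (σ j), ‖h y‖)
    (hK : ∀ y, HasSum (fun j => (zball p n (σ j)).indicator (fun y => (κ j : ℂ) * h y) y)
      (K y * h y)) :
    Integrable (fun y => K y * h y) ∧
      HasSum (fun j => (κ j : ℂ) * ∫ y in zball p n (σ j), h y) (∫ y, K y * h y) := by
  have hF : ∀ j, Integrable ((zball p n (σ j)).indicator (fun y => (κ j : ℂ) * h y)) := fun j =>
    (integrable_indicator_iff (measurableSet_zball _)).2 ((hh _).const_mul _)
  have hs' : Summable fun j =>
      ∫ y, ‖(zball p n (σ j)).indicator (fun y => (κ j : ℂ) * h y) y‖ := by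
    refine hs.congr fun j => ?_
    simp only [norm_indicator_eq_indicator_norm]
    rw [integral_indicator (measurableSet_zball _), ← integral_const_mul]
    simp [abs_of_nonneg (hκ j)]
  refine ⟨integrable_of_hasSum hF hs' (Eventually.of_forall hK), ?_⟩
  have := hasSum_integral_of_summable_integral_norm hF hs'
  simp only [(hK _).tsum_eq] at this
  refine this.congr_fun fun j => ?_
  rw [integral_indicator (measurableSet_zball _), integral_const_mul]

end mixture

/-! ### Ball averages -/

section averages

/-- The average of `g` over the ball of radius `p ^ j` about `x`. -/
def ballAvg (j : ℤ) (g : (Fin n → ℚ_[p]) → ℂ) (x : Fin n → ℚ_[p]) : ℂ :=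
  ((((p : ℝ) ^ n) ^ (-j) : ℝ) : ℂ) * ∫ y in zball p n j, g (x - y)

variable {g : (Fin n → ℚ_[p]) → ℂ} {x : Fin n → ℚ_[p]} {i j l : ℤ}

theorem constAt_iff : ConstAt l g x ↔ ∀ y ∈ zball p n l, g (x + y) = g x := by
  simp only [ConstAt, mem_zball]

theorem ConstAt.mono (h : ConstAt l g x) {m : ℤ} (hm : m ≤ l) : ConstAt m g x := by
  rw [constAt_iff] at *
  exact fun y hy => h y (zball_mono hm hy)

theorem ConstAt.sub_eq (h : ConstAt l g x) {y : Fin n → ℚ_[p]} (hy : y ∈ zball p n l) :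
    g (x - y) = g x := by
  rw [sub_eq_add_neg]
  exact constAt_iff.1 h _ (neg_mem_zball hy)

theorem isLocallyConstant_of_constAt {l : (Fin n → ℚ_[p]) → ℤ} (h : ∀ x, ConstAt (l x) g x) :
    IsLocallyConstant g := by
  have hp := prime_cast_pos p
  refine (IsLocallyConstant.iff_eventually_eq _).2 fun x => ?_
  filter_upwards [Metric.closedBall_mem_nhds x (show 0 < (p : ℝ) ^ l x by positivity)] with y hy
  rw [Metric.mem_closedBall, dist_eq_norm, ← mem_zball] at hy
  rw [← constAt_iff.1 (h x) _ hy, add_sub_cancel]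

theorem exists_constAt_of_isLocallyConstant (h : IsLocallyConstant g) (x : Fin n → ℚ_[p]) :
    ∃ l : ℤ, ConstAt l g x := by
  obtain ⟨ε, hε, hb⟩ := Metric.eventually_nhds_iff.1 ((IsLocallyConstant.iff_eventually_eq _).1 h x)
  have hp := one_lt_prime_cast p
  obtain ⟨k, hk⟩ := exists_pow_lt_of_lt_one hε (inv_lt_one_of_one_lt₀ hp)
  refine ⟨-k, constAt_iff.2 fun y hy => hb ?_⟩
  rw [dist_eq_norm, add_sub_cancel_left]
  rw [mem_zball, zpow_neg, zpow_natCast, ← inv_pow] at hy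
  exact hy.trans_lt hk

theorem integrableOn_zball (hg : Continuous g) (x : Fin n → ℚ_[p]) (j : ℤ) :
    IntegrableOn (fun y => g (x - y)) (zball p n j) :=
  (hg.comp (continuous_const.sub continuous_id)).continuousOn.integrableOn_compact
    (isCompact_zball j)

theorem normalization_mul (p : ℕ) [Fact p.Prime] (n : ℕ) (j : ℤ) :
    ((p : ℝ) ^ n) ^ (-j) * ((p : ℝ) ^ n) ^ j = 1 := by
  have hp := prime_cast_pos p
  rw [← zpow_add₀ (by positivity), neg_add_cancel, zpow_zero]

theorem ballAvg_eq_of_forall {c : ℂ} (h : ∀ y ∈ zball p n j, g (x - y) = c) :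
    ballAvg j g x = c := by
  rw [ballAvg, setIntegral_congr_fun (measurableSet_zball j) h, setIntegral_const,
    measureReal_zball, Complex.real_smul, ← mul_assoc, ← Complex.ofReal_mul, normalization_mul,
    Complex.ofReal_one, one_mul]

theorem ballAvg_of_constAt (h : ConstAt l g x) (hj : j ≤ l) : ballAvg j g x = g x :=
  ballAvg_eq_of_forall fun _ hy => h.sub_eq (zball_mono hj hy)

theorem ballAvg_add_of_mem {y : Fin n → ℚ_[p]} (hy : y ∈ zball p n j) :
    ballAvg j g (x + y) = ballAvg j g x := by
  unfold ballAvg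
  congr 1
  rw [← integral_indicator (measurableSet_zball j), ← integral_indicator (measurableSet_zball j),
    ← integral_add_left_eq_self (μ := volume) _ y]
  refine integral_congr_ae (Eventually.of_forall fun z => ?_)
  change indicator _ _ (y + z) = indicator _ _ z
  by_cases hz : z ∈ zball p n j
  · rw [indicator_of_mem hz, indicator_of_mem (add_mem_zball hy hz)]
    congr 1; abel
  · rw [indicator_of_notMem hz, indicator_of_notMem]
    intro hh
    apply hz
    have := sub_mem_zball hh hy
    rwa [add_sub_cancel_left] at this

theorem ConstAt.ballAvg (h : ConstAt l g x) (j : ℤ) : ConstAt l (ballAvg j g) x := by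
  rw [constAt_iff]
  intro y hy
  rcases le_total j l with hj | hj
  · rw [ballAvg_of_constAt h hj]
    refine ballAvg_eq_of_forall fun z hz => ?_
    rw [add_sub_assoc]
    exact constAt_iff.1 h _ (sub_mem_zball hy (zball_mono hj hz))
  · exact ballAvg_add_of_mem (zball_mono hj hy)

theorem continuous_ballAvg (j : ℤ) : Continuous (ballAvg j g) :=
  (isLocallyConstant_of_constAt (l := fun _ => j) fun _ =>
    constAt_iff.2 fun _ hy => ballAvg_add_of_mem hy).continuous

theorem ballAvg_comm (hg : Continuous g) (i j : ℤ) (x : Fin n → ℚ_[p]) :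
    ballAvg i (ballAvg j g) x = ballAvg j (ballAvg i g) x := by
  simp only [ballAvg, integral_const_mul]
  rw [mul_left_comm]
  congr 2
  rw [integral_integral_swap]
  · simp only [sub_right_comm]
  · rw [Measure.prod_restrict]
    refine ContinuousOn.integrableOn_compact ((isCompact_zball i).prod (isCompact_zball j)) ?_
    exact (hg.comp (by fun_prop : Continuous fun z : (Fin n → ℚ_[p]) × (Fin n → ℚ_[p]) =>
      x - z.1 - z.2)).continuousOn

/-- An average over the larger ball is constant on smaller balls, so a further small average does
nothing; the other order follows from commutativity. -/
theorem ballAvg_ballAvg (hg : Continuous g) (i j : ℤ) (x : Fin n → ℚ_[p]) :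
    ballAvg i (ballAvg j g) x = ballAvg (max i j) g x := by
  have key : ∀ {i j : ℤ}, i ≤ j → ballAvg i (ballAvg j g) x = ballAvg j g x := fun hij =>
    ballAvg_of_constAt (constAt_iff.2 fun _ hy => ballAvg_add_of_mem hy) hij
  rcases le_total i j with h | h
  · rw [max_eq_right h, key h]
  · rw [max_eq_left h, ballAvg_comm hg, key h]

theorem norm_ballAvg_le {B : ℝ} (h : ∀ y ∈ zball p n j, ‖g (x - y)‖ ≤ B) :
    ‖ballAvg j g x‖ ≤ B := by
  have hp := prime_cast_pos p
  have := norm_setIntegral_le_of_norm_le_const (μ := volume)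
    (by rw [volume_zball]; exact ENNReal.ofReal_lt_top) h
  rw [measureReal_zball] at this
  rw [ballAvg, norm_mul, Complex.norm_real, Real.norm_of_nonneg (by positivity)]
  calc _ ≤ ((p : ℝ) ^ n) ^ (-j) * (B * ((p : ℝ) ^ n) ^ j) := by gcongr
    _ = B := by rw [mul_left_comm, normalization_mul, mul_one]

theorem max_rpow_le_add {a b lam : ℝ} (ha : 0 ≤ a) (hb : 0 ≤ b) :
    max a b ^ lam ≤ a ^ lam + b ^ lam := by
  rcases max_choice a b with h | h <;> rw [h]
  · linarith [Real.rpow_nonneg hb lam]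
  · linarith [Real.rpow_nonneg ha lam]

theorem zpow_rpow_comm (p : ℕ) [Fact p.Prime] (lam : ℝ) (j : ℤ) :
    ((p : ℝ) ^ j) ^ lam = ((p : ℝ) ^ lam) ^ j := by
  have hp := prime_cast_pos p
  rw [← Real.rpow_intCast, ← Real.rpow_mul hp.le, mul_comm, Real.rpow_mul hp.le, Real.rpow_intCast]

theorem growth_sub_le {lam : ℝ} (hlam : 0 ≤ lam) (x : Fin n → ℚ_[p]) {y : Fin n → ℚ_[p]}
    (hy : y ∈ zball p n j) :
    1 + ‖x - y‖ ^ lam ≤ 1 + ‖x‖ ^ lam + ((p : ℝ) ^ lam) ^ j := by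
  have hp := prime_cast_pos p
  have h1 : ‖x - y‖ ≤ max ‖x‖ ((p : ℝ) ^ j) := by
    rw [sub_eq_add_neg]
    refine (IsUltrametricDist.norm_add_le_max _ _).trans (max_le_max le_rfl ?_)
    rwa [norm_neg, ← mem_zball]
  have h2 := Real.rpow_le_rpow (norm_nonneg _) h1 hlam
  have h3 := max_rpow_le_add (a := ‖x‖) (b := (p : ℝ) ^ j) (lam := lam) (norm_nonneg _)
    (by positivity)
  rw [zpow_rpow_comm] at h3
  linarith

theorem norm_ballAvg_le_growth {lam C : ℝ} (hlam : 0 ≤ lam) (hC : 0 ≤ C)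
    (hg : ∀ x, ‖g x‖ ≤ C * (1 + ‖x‖ ^ lam)) (j : ℤ) (x : Fin n → ℚ_[p]) :
    ‖ballAvg j g x‖ ≤ C * (1 + ‖x‖ ^ lam + ((p : ℝ) ^ lam) ^ j) :=
  norm_ballAvg_le fun _ hy => (hg _).trans
    (mul_le_mul_of_nonneg_left (growth_sub_le hlam x hy) hC)

/-- Averages over a fixed ball are given by one finite combination of point values, for all
functions with the same radii of constancy. -/
theorem exists_ballAvg_eq_sum (l : (Fin n → ℚ_[p]) → ℤ) (j : ℤ) (x : Fin n → ℚ_[p]) :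
    ∃ c : (Fin n → ℚ_[p]) →₀ ℂ, ∀ g : (Fin n → ℚ_[p]) → ℂ, (∀ z, ConstAt (l z) g z) →
      ballAvg j g x = c.sum fun z a => a * g z := by
  have hp := prime_cast_pos p
  -- Compactness reduces the claim to neighbourhoods of points, where the coefficient is the measure
  -- of the piece. It is proved for all measurable `T'` inside `T` so that a union can be cut into
  -- disjoint pieces.
  suffices h : ∃ T, zball p n j ⊆ T ∧ MeasurableSet T ∧ T ⊆ zball p n j ∧
      ∀ T' ⊆ T, MeasurableSet T' → ∃ c : (Fin n → ℚ_[p]) →₀ ℂ, ∀ g : (Fin n → ℚ_[p]) → ℂ,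
        (∀ z, ConstAt (l z) g z) → ∫ y in T', g (x - y) = c.sum fun z a => a * g z by
    obtain ⟨T, hT, -, -, h⟩ := h
    obtain ⟨c, hc⟩ := h _ hT (measurableSet_zball j)
    refine ⟨((((p : ℝ) ^ n) ^ (-j) : ℝ) : ℂ) • c, fun g hg => ?_⟩
    rw [Finsupp.sum_smul_index (by simp), ballAvg, hc g hg, Finsupp.mul_sum]
    simp only [mul_assoc]
  refine (isCompact_zball j).induction_on (p := fun S => ∃ T, S ⊆ T ∧ MeasurableSet T ∧
      T ⊆ zball p n j ∧ ∀ T' ⊆ T, MeasurableSet T' → ∃ c : (Fin n → ℚ_[p]) →₀ ℂ,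
        ∀ g : (Fin n → ℚ_[p]) → ℂ, (∀ z, ConstAt (l z) g z) →
          ∫ y in T', g (x - y) = c.sum fun z a => a * g z) ?_ ?_ ?_ ?_
  · refine ⟨∅, le_rfl, MeasurableSet.empty, empty_subset _, fun T' hT' _ => ⟨0, fun g _ => ?_⟩⟩
    rw [subset_empty_iff.1 hT']; simp
  · rintro s t hst ⟨T, h1, h2⟩
    exact ⟨T, hst.trans h1, h2⟩
  · rintro s t ⟨S, hS, mS, bS, iS⟩ ⟨T, hT, mT, bT, iT⟩
    refine ⟨S ∪ T, union_subset_union hS hT, mS.union mT, union_subset bS bT, fun T' hT' mT' => ?_⟩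
    obtain ⟨c1, h1⟩ := iS (T' ∩ S) inter_subset_right (mT'.inter mS)
    obtain ⟨c2, h2⟩ := iT (T' \ S) (by
      rintro y ⟨hy, hy'⟩; exact (hT' hy).resolve_left hy') (mT'.diff mS)
    refine ⟨c1 + c2, fun g hg => ?_⟩
    rw [Finsupp.sum_add_index' (by simp) (by intros; ring), ← h1 g hg, ← h2 g hg,
      integral_inter_add_sdiff mS]
    exact (integrableOn_zball (isLocallyConstant_of_constAt hg).continuous x j).mono_set
      (hT'.trans (union_subset bS bT))
  · intro y hy
    set U := Metric.closedBall y ((p : ℝ) ^ l (x - y)) with hU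
    have mU : MeasurableSet (U ∩ zball p n j) :=
      Metric.isClosed_closedBall.measurableSet.inter (measurableSet_zball j)
    refine ⟨U ∩ zball p n j, inter_mem (mem_nhdsWithin_of_mem_nhds
      (Metric.closedBall_mem_nhds _ (by positivity))) self_mem_nhdsWithin, _, le_rfl, mU,
      inter_subset_right, fun T' hT' mT' => ⟨Finsupp.single (x - y) ((volume.real T' : ℝ) : ℂ),
        fun g hg => ?_⟩⟩
    rw [Finsupp.sum_single_index (by simp), setIntegral_congr_fun mT' (g := fun _ => g (x - y)),
      setIntegral_const, Complex.real_smul]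
    intro z hz
    have hz' := (hT' hz).1
    rw [hU, Metric.mem_closedBall, dist_eq_norm, ← mem_zball] at hz'
    have := (hg (x - y)).sub_eq hz'
    rwa [sub_sub, add_sub_cancel] at this

variable {l : (Fin n → ℚ_[p]) → ℤ}

/-- Pointwise convergence is enough, because the average is a finite combination of point values
that is the same for every summand and for the limit. -/
theorem hasSum_ballAvg {ι : Type*} {G : ι → (Fin n → ℚ_[p]) → ℂ}
    (hG : ∀ k z, ConstAt (l z) (G k) z) (hs : ∀ z, HasSum (fun k => G k z) (g z)) (j : ℤ)
    (x : Fin n → ℚ_[p]) : HasSum (fun k => ballAvg j (G k) x) (ballAvg j g x) := by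
  have hg : ∀ z, ConstAt (l z) g z := fun z => constAt_iff.2 fun y hy =>
    (hs (z + y)).unique ((hs z).congr_fun fun k => constAt_iff.1 (hG k z) y hy)
  obtain ⟨c, hc⟩ := exists_ballAvg_eq_sum l j x
  rw [hc g hg]
  simp only [hc _ (hG _)]
  exact hasSum_sum fun z _ => (hs z).mul_left _

theorem ballAvg_intervalIntegral {G : (Fin n → ℚ_[p]) → ℝ → ℂ}
    (hG : ∀ τ z, ConstAt (l z) (fun z => G z τ) z) {a b : ℝ}
    (hi : ∀ z, IntervalIntegrable (G z) volume a b) (j : ℤ) (x : Fin n → ℚ_[p]) :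
    ballAvg j (fun z => ∫ τ in a..b, G z τ) x = ∫ τ in a..b, ballAvg j (fun z => G z τ) x := by
  have hg : ∀ z, ConstAt (l z) (fun z => ∫ τ in a..b, G z τ) z := fun z =>
    constAt_iff.2 fun y hy => by
      simp only [constAt_iff.1 (hG _ z) y hy]
  obtain ⟨c, hc⟩ := exists_ballAvg_eq_sum l j x
  rw [hc _ hg]
  simp only [hc _ (hG _), Finsupp.sum]
  rw [intervalIntegral.integral_finsetSum fun z _ => (hi z).const_mul _]
  simp only [intervalIntegral.integral_const_mul]

theorem continuousOn_ballAvg {G : (Fin n → ℚ_[p]) → ℝ → ℂ}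
    (hG : ∀ τ z, ConstAt (l z) (fun z => G z τ) z) {S : Set ℝ}
    (hc : ∀ z, ContinuousOn (G z) S) (j : ℤ) (x : Fin n → ℚ_[p]) :
    ContinuousOn (fun τ => ballAvg j (fun z => G z τ) x) S := by
  obtain ⟨c, h⟩ := exists_ballAvg_eq_sum l j x
  simp only [h _ (hG _), Finsupp.sum]
  exact continuousOn_finsetSum _ fun z _ => (hc z).const_mul _

theorem ballAvg_add {f g : (Fin n → ℚ_[p]) → ℂ} (hf : Continuous f) (hg : Continuous g) (j : ℤ)
    (x : Fin n → ℚ_[p]) :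
    ballAvg j (fun z => f z + g z) x = ballAvg j f x + ballAvg j g x := by
  rw [ballAvg, integral_add (integrableOn_zball hf x j) (integrableOn_zball hg x j), mul_add]; rfl

theorem ballAvg_sub {f g : (Fin n → ℚ_[p]) → ℂ} (hf : Continuous f) (hg : Continuous g) (j : ℤ)
    (x : Fin n → ℚ_[p]) :
    ballAvg j (fun z => f z - g z) x = ballAvg j f x - ballAvg j g x := by
  rw [ballAvg, integral_sub (integrableOn_zball hf x j) (integrableOn_zball hg x j), mul_sub]; rfl

theorem ballAvg_const_mul (c : ℂ) (j : ℤ) (x : Fin n → ℚ_[p]) :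
    ballAvg j (fun z => c * g z) x = c * ballAvg j g x := by
  rw [ballAvg, integral_const_mul, mul_left_comm]; rfl

end averages

/-! ### The heat kernel and the Taibleson kernel as superpositions of balls -/

section kernels

theorem one_lt_prime_rpow (p : ℕ) [Fact p.Prime] {α : ℝ} (hα : 0 < α) : 1 < (p : ℝ) ^ α :=
  Real.one_lt_rpow (one_lt_prime_cast p) hα

theorem one_le_prime_pow (p : ℕ) [Fact p.Prime] (n : ℕ) : 1 ≤ (p : ℝ) ^ n :=
  one_le_pow₀ (one_lt_prime_cast p).le

/-- For ‖ξ‖ = p^m exactly the indices j ≤ -m survive, and their weights telescope to exp(-atQ^m). At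
ξ = 0 all survive, with total mass 1. -/
theorem hasSum_weight_indicator {a α t : ℝ} (ha : 0 < a) (hα : 0 < α) (ht : 0 < t)
    (ξ : Fin n → ℚ_[p]) :
    HasSum (fun j : ℤ => (zball p n (-j)).indicator (fun _ => weight a ((p : ℝ) ^ α) j t) ξ)
      (Real.exp (-(a * t * ‖ξ‖ ^ α))) := by
  have hQ := one_lt_prime_rpow p hα
  rcases eq_or_ne ξ 0 with rfl | hξ
  · simp only [indicator_of_mem (zero_mem_zball _), norm_zero, Real.zero_rpow hα.ne', mul_zero,
      neg_zero, Real.exp_zero]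
    exact hasSum_weight ha hQ ht
  · obtain ⟨m, hm⟩ := exists_norm_eq_zpow hξ
    have h := hasSum_weight_Iic ha hQ ht (-m)
    rw [decay, neg_neg, ← zpow_rpow_comm, ← hm] at h
    refine h.congr_fun fun j => ?_
    simp only [indicator, mem_zball, hm, zpow_le_zpow_iff_right₀ (one_lt_prime_cast p), le_neg]

theorem hasSum_heatKernel {a α t : ℝ} (ha : 0 < a) (hα : 0 < α) (ht : 0 < t)
    (x : Fin n → ℚ_[p]) :
    HasSum (fun j : ℤ => (zball p n j).indicator
      (fun _ => ((weight a ((p : ℝ) ^ α) j t * ((p : ℝ) ^ n) ^ (-j) : ℝ) : ℂ)) x)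
      (heatKernel a α x t) := by
  have hQ := one_lt_prime_rpow p hα
  have hp := prime_cast_pos p
  have h := (integrable_and_hasSum_integral_of_mixture
    (κ := fun j => weight a ((p : ℝ) ^ α) j t) (fun j => weight_nonneg ha.le hQ ht.le)
    (σ := fun j => -j) (h := fun ξ : Fin n → ℚ_[p] => stdChar (∑ i, x i * ξ i))
    (K := fun ξ => ((Real.exp (-(a * t * ‖ξ‖ ^ α)) : ℝ) : ℂ)) ?_ ?_ ?_).2
  · have e : heatKernel a α x t = ∫ ξ : Fin n → ℚ_[p],
        ((Real.exp (-(a * t * ‖ξ‖ ^ α)) : ℝ) : ℂ) * stdChar (∑ i, x i * ξ i) :=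
      integral_congr_ae (Eventually.of_forall fun ξ => mul_comm _ _)
    rw [e]
    refine h.congr_fun fun j => ?_
    rw [setIntegral_stdChar]
    by_cases hx : x ∈ zball p n j
    · simp [indicator_of_mem hx]
    · simp [indicator_of_notMem hx]
  · exact fun j => (continuous_stdChar_sum x).continuousOn.integrableOn_compact (isCompact_zball j)
  · simp only [norm_stdChar, setIntegral_const, measureReal_zball, smul_eq_mul, mul_one]
    refine (summable_weight_mul_zpow ha hQ ht (N := ((p : ℝ) ^ n)⁻¹) (by positivity) ?_).congr
      fun j => by rw [inv_zpow']
    exact mul_lt_one_of_nonneg_of_lt_one_left (by positivity) (inv_lt_one_of_one_lt₀ hQ)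
      (inv_le_one_of_one_le₀ (one_le_prime_pow p n))
  · intro ξ
    have h := ((Complex.hasSum_ofReal.2 (hasSum_weight_indicator ha hα ht ξ))).mul_right
      (stdChar (∑ i, x i * ξ i))
    refine h.congr_fun fun j => ?_
    by_cases hx : ξ ∈ zball p n (-j)
    · simp [indicator_of_mem hx]
    · simp [indicator_of_notMem hx]

/-- The deviation of the average over the ball of radius `p ^ j` about `x` from the value
at `x`. -/
def avgDev (j : ℤ) (g : (Fin n → ℚ_[p]) → ℂ) (x : Fin n → ℚ_[p]) : ℂ :=
  ballAvg j g x - g x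

theorem setIntegral_sub_eq_avgDev {g : (Fin n → ℚ_[p]) → ℂ} (hg : Continuous g) (j : ℤ)
    (x : Fin n → ℚ_[p]) :
    ∫ y in zball p n j, (g (x - y) - g x) = ((((p : ℝ) ^ n) ^ j : ℝ) : ℂ) * avgDev j g x := by
  have hp := prime_cast_pos p
  rw [integral_sub (integrableOn_zball hg x j) (continuousOn_const.integrableOn_compact
    (isCompact_zball j)), setIntegral_const, measureReal_zball, avgDev, mul_sub, ballAvg,
    ← mul_assoc, ← Complex.ofReal_mul, mul_comm (((p : ℝ) ^ n) ^ j), normalization_mul]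
  simp

theorem avgDev_of_constAt {g : (Fin n → ℚ_[p]) → ℂ} {x : Fin n → ℚ_[p]} {l j : ℤ}
    (h : ConstAt l g x) (hj : j ≤ l) : avgDev j g x = 0 := by
  rw [avgDev, ballAvg_of_constAt h hj, sub_self]

section growth

variable {lam C : ℝ} {g : (Fin n → ℚ_[p]) → ℂ} {x : Fin n → ℚ_[p]} {l : ℤ}

theorem norm_sub_le_growth (hlam : 0 ≤ lam) (hC : 0 ≤ C)
    (hg : ∀ x, ‖g x‖ ≤ C * (1 + ‖x‖ ^ lam)) {j : ℤ} {y : Fin n → ℚ_[p]} (hy : y ∈ zball p n j) :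
    ‖g (x - y) - g x‖ ≤ 2 * C * (1 + ‖x‖ ^ lam + ((p : ℝ) ^ lam) ^ j) := by
  have hp := prime_cast_pos p
  have h1 := (hg (x - y)).trans (mul_le_mul_of_nonneg_left (growth_sub_le hlam x hy) hC)
  have h2 : 0 ≤ C * ((p : ℝ) ^ lam) ^ j := by positivity
  linarith [norm_sub_le (g (x - y)) (g x), hg x]

theorem norm_avgDev_le_growth (hlam : 0 ≤ lam) (hC : 0 ≤ C)
    (hg : ∀ x, ‖g x‖ ≤ C * (1 + ‖x‖ ^ lam)) (j : ℤ) :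
    ‖avgDev j g x‖ ≤ 2 * C * (1 + ‖x‖ ^ lam + ((p : ℝ) ^ lam) ^ j) := by
  have hp := prime_cast_pos p
  have h1 := norm_ballAvg_le_growth hlam hC hg j x
  have h2 : 0 ≤ C * ((p : ℝ) ^ lam) ^ j := by positivity
  rw [avgDev]
  linarith [norm_sub_le (ballAvg j g x) (g x), hg x]

/-- The constant in the bound for deviations over balls of radius above `p ^ l`. -/
def devBound (p : ℕ) (lam C : ℝ) (r : ℝ) (l : ℤ) : ℝ :=
  2 * C * ((1 + r ^ lam) * ((p : ℝ) ^ lam) ^ (-l) + 1)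

/-- Above the radius of constancy 1 ≤ p^(λ(j-l)), so the bounded part is absorbed into a pure
multiple of p^(λj). -/
theorem growth_le_devBound (hlam : 0 ≤ lam) (hC : 0 ≤ C) {r : ℝ} (hr : 0 ≤ r) {j : ℤ}
    (hj : l < j) :
    2 * C * (1 + r ^ lam + ((p : ℝ) ^ lam) ^ j) ≤
      devBound p lam C r l * ((p : ℝ) ^ lam) ^ j := by
  have hp := prime_cast_pos p
  have hR : 1 ≤ (p : ℝ) ^ lam := Real.one_le_rpow (one_lt_prime_cast p).le hlam
  have h1 : 1 ≤ ((p : ℝ) ^ lam) ^ (-l) * ((p : ℝ) ^ lam) ^ j := by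
    rw [← zpow_add₀ (by positivity)]
    exact one_le_zpow₀ hR (by lia)
  rw [devBound, mul_assoc (2 * C)]
  refine mul_le_mul_of_nonneg_left ?_ (by positivity)
  have h2 : 0 ≤ 1 + r ^ lam := by positivity
  have := mul_le_mul_of_nonneg_left h1 h2
  linarith

end growth

section integrals

variable {lam C α a t : ℝ} {g : (Fin n → ℚ_[p]) → ℂ} {l : ℤ}

theorem rpow_ratio_lt_one (p : ℕ) [Fact p.Prime] (hlamα : lam < α) :
    (((p : ℝ) ^ α)⁻¹ * (p : ℝ) ^ lam) < 1 := by
  have hp := prime_cast_pos p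
  rw [inv_mul_lt_one₀ (by positivity)]
  exact Real.rpow_lt_rpow_of_exponent_lt (one_lt_prime_cast p) hlamα

theorem summable_weight_mul_growth (ha : 0 < a) (hα : 0 < α) (hlamα : lam < α) (ht : 0 < t)
    (r : ℝ) :
    Summable fun j : ℤ => weight a ((p : ℝ) ^ α) j t * (r + ((p : ℝ) ^ lam) ^ j) := by
  have hp := prime_cast_pos p
  have hQ := one_lt_prime_rpow p hα
  refine (((hasSum_weight ha hQ ht).summable.mul_right r).add (summable_weight_mul_zpow ha hQ ht
    (N := (p : ℝ) ^ lam) (by positivity) (rpow_ratio_lt_one p hlamα))).congr fun j => ?_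
  ring

theorem integrable_and_hasSum_heatKernel_mul (ha : 0 < a) (hα : 0 < α) (hlam : 0 ≤ lam)
    (hlamα : lam < α) (ht : 0 < t) (hC : 0 ≤ C) (hgc : Continuous g)
    (hg : ∀ x, ‖g x‖ ≤ C * (1 + ‖x‖ ^ lam)) (x : Fin n → ℚ_[p]) :
    Integrable (fun ξ => heatKernel a α (x - ξ) t * g ξ) ∧
      HasSum (fun j => (weight a ((p : ℝ) ^ α) j t : ℂ) * ballAvg j g x)
        (∫ ξ, heatKernel a α (x - ξ) t * g ξ) := by
  have hQ := one_lt_prime_rpow p hα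
  have hp := prime_cast_pos p
  have h := (integrable_and_hasSum_integral_of_mixture
    (κ := fun j => weight a ((p : ℝ) ^ α) j t * ((p : ℝ) ^ n) ^ (-j))
    (fun j => mul_nonneg (weight_nonneg ha.le hQ ht.le) (by positivity))
    (σ := fun j => j) (h := fun y => g (x - y))
    (K := fun y => heatKernel a α y t) (integrableOn_zball hgc x) ?_ ?_)
  · have e : (fun ξ => heatKernel a α (x - ξ) t * g ξ) =
        fun ξ => (fun y => heatKernel a α y t * g (x - y)) (x - ξ) := by
      funext ξ; simp
    rw [e]
    refine ⟨h.1.comp_sub_left x, ?_⟩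
    rw [integral_sub_left_eq_self (fun y => heatKernel a α y t * g (x - y)) volume x]
    refine h.2.congr_fun fun j => ?_
    rw [ballAvg]; push_cast; ring
  · refine Summable.of_nonneg_of_le (fun j => ?_) (fun j => ?_)
      ((summable_weight_mul_growth (p := p) ha hα hlamα ht (1 + ‖x‖ ^ lam)).mul_left C)
    · exact mul_nonneg (mul_nonneg (weight_nonneg ha.le hQ ht.le) (by positivity)) (by positivity)
    · have h1 : ∫ y in zball p n j, ‖g (x - y)‖ ≤
          C * (1 + ‖x‖ ^ lam + ((p : ℝ) ^ lam) ^ j) * ((p : ℝ) ^ n) ^ j := by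
        have := norm_setIntegral_le_of_norm_le_const (μ := volume) (s := zball p n j)
          (f := fun y => ‖g (x - y)‖) (C := C * (1 + ‖x‖ ^ lam + ((p : ℝ) ^ lam) ^ j))
          (by rw [volume_zball]; exact ENNReal.ofReal_lt_top) (fun y hy => by
            rw [norm_norm]
            exact (hg _).trans (mul_le_mul_of_nonneg_left (growth_sub_le hlam x hy) hC))
        rw [measureReal_zball] at this
        exact (le_abs_self _).trans this
      calc _ ≤ weight a ((p : ℝ) ^ α) j t * ((p : ℝ) ^ n) ^ (-j) *
            (C * (1 + ‖x‖ ^ lam + ((p : ℝ) ^ lam) ^ j) * ((p : ℝ) ^ n) ^ j) :=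
          mul_le_mul_of_nonneg_left h1
            (mul_nonneg (weight_nonneg ha.le hQ ht.le) (by positivity))
        _ = C * (weight a ((p : ℝ) ^ α) j t * (1 + ‖x‖ ^ lam + ((p : ℝ) ^ lam) ^ j)) *
            (((p : ℝ) ^ n) ^ (-j) * ((p : ℝ) ^ n) ^ j) := by ring
        _ = _ := by rw [normalization_mul, mul_one]
  · intro y
    refine ((hasSum_heatKernel ha hα ht y).mul_right (g (x - y))).congr_fun fun j => ?_
    by_cases hy : y ∈ zball p n j
    · simp [indicator_of_mem hy]
    · simp [indicator_of_notMem hy]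

theorem hasSum_weight_mul_avgDev (ha : 0 < a) (hα : 0 < α) (hlam : 0 ≤ lam)
    (hlamα : lam < α) (ht : 0 < t) (hC : 0 ≤ C) (hgc : Continuous g)
    (hg : ∀ x, ‖g x‖ ≤ C * (1 + ‖x‖ ^ lam)) (x : Fin n → ℚ_[p]) :
    HasSum (fun j => (weight a ((p : ℝ) ^ α) j t : ℂ) * avgDev j g x)
        ((∫ ξ, heatKernel a α (x - ξ) t * g ξ) - g x) := by
  have h1 := (Complex.hasSum_ofReal.2 (hasSum_weight ha (one_lt_prime_rpow p hα) ht)).mul_right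
    (g x)
  rw [Complex.ofReal_one, one_mul] at h1
  refine ((integrable_and_hasSum_heatKernel_mul ha hα hlam hlamα ht hC hgc hg x).2.sub
    h1).congr_fun fun j => ?_
  rw [avgDev, mul_sub]

theorem rpow_neg_sub_eq (p : ℕ) [Fact p.Prime] (n : ℕ) (α : ℝ) :
    (p : ℝ) ^ (-α - n) = ((p : ℝ) ^ n * (p : ℝ) ^ α)⁻¹ := by
  have hp := prime_cast_pos p
  rw [← neg_add', Real.rpow_neg hp.le, Real.rpow_add hp, Real.rpow_natCast, mul_comm]

/-- For ‖y‖ = p^m the series is the geometric tail over j ≥ m, summed by telescoping -P^(-(j+1))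
with P = p^(n+α). -/
theorem hasSum_taibleson_kernel (hα : 0 < α) {y : Fin n → ℚ_[p]} (hy : y ≠ 0) :
    HasSum (fun j : ℤ => (zball p n j).indicator (fun _ => (1 - ((p : ℝ) ^ n * (p : ℝ) ^ α)⁻¹) *
      ((p : ℝ) ^ n * (p : ℝ) ^ α) ^ (-j)) y) (‖y‖ ^ (-α - (n : ℝ))) := by
  have hp := prime_cast_pos p
  set P := (p : ℝ) ^ n * (p : ℝ) ^ α with hP
  have hP1 : 1 < P := one_lt_mul_of_le_of_lt (one_le_prime_pow p n) (one_lt_prime_rpow p hα)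
  obtain ⟨m, hm⟩ := exists_norm_eq_zpow hy
  have hF : Monotone fun j : ℤ => -P ^ (-(j + 1)) := fun a b hab =>
    neg_le_neg (zpow_le_zpow_right₀ hP1.le (by lia))
  have hB : Tendsto (fun j : ℤ => -P ^ (-(j + 1))) atTop (𝓝 (-0)) := by
    refine Tendsto.neg ?_
    refine ((tendsto_zpow_int_atTop (r := P⁻¹) (by positivity) (inv_lt_one_of_one_lt₀ hP1)).comp
      (tendsto_atTop_add_const_right _ (1 : ℤ) tendsto_id)).congr fun j => ?_
    simp only [Function.comp_apply, id, inv_zpow']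
  have h := hasSum_Ioi_sub hF hB (m - 1)
  rw [hm, zpow_rpow_comm, rpow_neg_sub_eq, ← hP, inv_zpow']
  rw [sub_add_cancel, neg_zero, zero_sub, neg_neg] at h
  refine h.congr_fun fun j => ?_
  simp only [indicator, mem_zball, hm, zpow_le_zpow_iff_right₀ (one_lt_prime_cast p),
    Int.sub_one_lt_iff]
  split_ifs
  · rw [sub_add_cancel, neg_add, zpow_add₀ (by positivity), zpow_neg_one]; ring
  · rfl

/-- The integral converges near the origin because g is constant there, and at infinity because λ <
α. The denominator of the normalizing constant cancels the factor 1 - P⁻¹ of the expansion, and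
P^(-j) times the volume p^(nj) is Q^(-j). -/
theorem integrable_and_hasSum_taibleson (hα : 0 < α) (hlam : 0 ≤ lam)
    (hlamα : lam < α) (hC : 0 ≤ C) (hgc : Continuous g)
    (hg : ∀ x, ‖g x‖ ≤ C * (1 + ‖x‖ ^ lam)) {x : Fin n → ℚ_[p]} (hl : ConstAt l g x) :
    Integrable (taiblesonIntegrand α g x) ∧
      HasSum (fun j => (((1 - (p : ℝ) ^ α) * ((p : ℝ) ^ α) ^ (-j) : ℝ) : ℂ) * avgDev j g x)
        (taibleson α g x) := by
  have hp := prime_cast_pos p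
  have hQ := one_lt_prime_rpow p hα
  set P := (p : ℝ) ^ n * (p : ℝ) ^ α with hP
  have hP1 : 1 < P := one_lt_mul_of_le_of_lt (one_le_prime_pow p n) hQ
  have hP0 : 0 < 1 - P⁻¹ := sub_pos.2 (inv_lt_one_of_one_lt₀ hP1)
  have hPQ : ∀ j : ℤ, P ^ (-j) * ((p : ℝ) ^ n) ^ j = ((p : ℝ) ^ α) ^ (-j) := fun j => by
    rw [hP, mul_zpow, mul_right_comm, normalization_mul, one_mul]
  have hκ : ∀ j : ℤ, 0 ≤ (1 - P⁻¹) * P ^ (-j) := fun j => by positivity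
  have hcont : Continuous fun y => g (x - y) - g x := by fun_prop
  have h := (integrable_and_hasSum_integral_of_mixture
    (κ := fun j => (1 - P⁻¹) * P ^ (-j)) hκ
    (σ := fun j => j) (h := fun y => g (x - y) - g x)
    (K := fun y => ((‖y‖ ^ (-α - (n : ℝ)) : ℝ) : ℂ))
    (fun j => hcont.continuousOn.integrableOn_compact (isCompact_zball j)) ?_ ?_)
  · refine ⟨h.1, ?_⟩
    have h2 := h.2.mul_left ((((1 - (p : ℝ) ^ α) / (1 - (p : ℝ) ^ (-α - (n : ℝ))) : ℝ)) : ℂ)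
    refine HasSum.congr_fun (a := taibleson α g x) h2 fun j => ?_
    have e : (1 - (p : ℝ) ^ α) * ((p : ℝ) ^ α) ^ (-j) =
        (1 - (p : ℝ) ^ α) / (1 - P⁻¹) * ((1 - P⁻¹) * P ^ (-j)) * ((p : ℝ) ^ n) ^ j := by
      rw [← mul_assoc (_ / _), div_mul_cancel₀ _ hP0.ne', ← hPQ, mul_assoc]
    rw [setIntegral_sub_eq_avgDev hgc, rpow_neg_sub_eq, ← hP, e]
    push_cast
    ring
  · have hs := summable_Ioi_zpow (r := ((p : ℝ) ^ α)⁻¹ * (p : ℝ) ^ lam) (by positivity)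
      (rpow_ratio_lt_one p hlamα) l
    refine Summable.of_nonneg_of_le (fun j => ?_) (fun j => ?_)
      (hs.mul_left ((1 - P⁻¹) * devBound p lam C ‖x‖ l))
    · exact mul_nonneg (hκ j) (by positivity)
    · split_ifs with hj
      · have h1 := norm_setIntegral_le_of_norm_le_const (μ := volume) (s := zball p n j)
          (f := fun y => ‖g (x - y) - g x‖) (C := devBound p lam C ‖x‖ l * ((p : ℝ) ^ lam) ^ j)
          (by rw [volume_zball]; exact ENNReal.ofReal_lt_top) (fun y hy => by
            rw [norm_norm]
            exact (norm_sub_le_growth hlam hC hg hy).trans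
              (growth_le_devBound hlam hC (norm_nonneg x) hj))
        rw [measureReal_zball] at h1
        calc _ ≤ (1 - P⁻¹) * P ^ (-j) *
              (devBound p lam C ‖x‖ l * ((p : ℝ) ^ lam) ^ j * ((p : ℝ) ^ n) ^ j) :=
            mul_le_mul_of_nonneg_left ((le_abs_self _).trans h1) (hκ j)
          _ = (1 - P⁻¹) * devBound p lam C ‖x‖ l * (((p : ℝ) ^ lam) ^ j *
              (P ^ (-j) * ((p : ℝ) ^ n) ^ j)) := by ring
          _ = _ := by rw [hPQ, mul_zpow, inv_zpow']; ring
      · rw [setIntegral_congr_fun (measurableSet_zball j) (g := fun _ => (0 : ℝ))]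
        · simp
        · intro y hy
          simp only [hl.sub_eq (zball_mono (not_lt.1 hj) hy), sub_self, norm_zero]
  · intro y
    -- At the origin the series for the kernel alone diverges, but g(x - y) - g(x) vanishes.
    rcases eq_or_ne y 0 with rfl | hy
    · rw [sub_zero, sub_self, mul_zero]
      refine hasSum_zero.congr_fun fun j => ?_
      simp [indicator]
    · refine ((Complex.hasSum_ofReal.2 (hasSum_taibleson_kernel hα hy)).mul_right
        (g (x - y) - g x)).congr_fun fun j => ?_
      by_cases hy : y ∈ zball p n j
      · simp [indicator_of_mem hy, hP]
      · simp [indicator_of_notMem hy]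

end integrals

end kernels

/-! ### Scalar modes in time and summation by parts -/

section modes

variable {a Q : ℝ} {B : ℤ → ℝ}

theorem norm_weight_mul_le (ha : 0 ≤ a) (hQ : 1 < Q) {s T : ℝ} (hs : 0 ≤ s) (hsT : s ≤ T) {j : ℤ}
    {c : ℂ} {b : ℝ} (hc : ‖c‖ ≤ b) :
    ‖(weight a Q j s : ℂ) * c‖ ≤ a * T * Q * (Q ^ (-j) * b) := by
  have hb : 0 ≤ b := (norm_nonneg c).trans hc
  have hT : 0 ≤ T := hs.trans hsT
  rw [norm_mul, Complex.norm_real, Real.norm_of_nonneg (weight_nonneg ha hQ hs), ← mul_assoc]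
  refine mul_le_mul ((weight_le ha hQ hs).trans ?_) hc (norm_nonneg _) (by positivity)
  gcongr

theorem summable_weight_mul (ha : 0 ≤ a) (hQ : 1 < Q) (hB : Summable fun j => Q ^ (-j) * B j)
    {s : ℝ} (hs : 0 ≤ s) {c : ℤ → ℂ} (hc : ∀ j, ‖c j‖ ≤ B j) :
    Summable fun j => (weight a Q j s : ℂ) * c j :=
  (hB.mul_left (a * s * Q)).of_norm_bounded fun j => norm_weight_mul_le ha hQ hs le_rfl (hc j)

theorem intervalIntegrable_mul_of_continuous {k : ℝ → ℝ} (hk : Continuous k) {b : ℝ → ℂ}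
    {s t : ℝ} (hb : IntervalIntegrable b volume s t) :
    IntervalIntegrable (fun τ => (k τ : ℂ) * b τ) volume s t :=
  hb.continuousOn_mul (Complex.continuous_ofReal.comp hk).continuousOn

theorem intervalIntegrable_and_hasSum_weight (ha : 0 ≤ a) (hQ : 1 < Q)
    (hB : Summable fun j => Q ^ (-j) * B j) {t : ℝ} (ht : 0 ≤ t) {b : ℤ → ℝ → ℂ}
    (hb : ∀ j τ, ‖b j τ‖ ≤ B j) (hi : ∀ j, IntervalIntegrable (b j) volume 0 t) :
    IntervalIntegrable (fun τ => ∑' j, (weight a Q j (t - τ) : ℂ) * b j τ) volume 0 t ∧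
      HasSum (fun j => ∫ τ in (0 : ℝ)..t, (weight a Q j (t - τ) : ℂ) * b j τ)
        (∫ τ in (0 : ℝ)..t, ∑' j, (weight a Q j (t - τ) : ℂ) * b j τ) := by
  simp only [intervalIntegrable_iff_integrableOn_Ioc_of_le ht,
    intervalIntegral.integral_of_le ht] at *
  have hF : ∀ j, IntegrableOn (fun τ => (weight a Q j (t - τ) : ℂ) * b j τ) (Ioc 0 t) := by
    intro j
    rw [← intervalIntegrable_iff_integrableOn_Ioc_of_le ht]
    refine intervalIntegrable_mul_of_continuous (continuous_weight.comp (by fun_prop)) ?_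
    rw [intervalIntegrable_iff_integrableOn_Ioc_of_le ht]
    exact hi j
  have hbd : ∀ j, ∀ τ ∈ Ioc 0 t,
      ‖(weight a Q j (t - τ) : ℂ) * b j τ‖ ≤ a * t * Q * (Q ^ (-j) * B j) := fun j τ hτ =>
    norm_weight_mul_le ha hQ (sub_nonneg.2 hτ.2) (by linarith [hτ.1]) (hb j τ)
  have hs : Summable fun j => ∫ τ in Ioc 0 t, ‖(weight a Q j (t - τ) : ℂ) * b j τ‖ := by
    refine Summable.of_nonneg_of_le (fun j => by positivity) (fun j => ?_)
      ((hB.mul_left (a * t * Q)).mul_right t)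
    have := norm_setIntegral_le_of_norm_le_const (μ := volume) (s := Ioc 0 t)
      (f := fun τ => ‖(weight a Q j (t - τ) : ℂ) * b j τ‖) (by simp)
      (fun τ hτ => by rw [norm_norm]; exact hbd j τ hτ)
    simp only [Real.volume_real_Ioc_of_le ht, sub_zero] at this
    exact (le_abs_self _).trans this
  refine ⟨integrable_of_hasSum hF hs ?_, hasSum_integral_of_summable_integral_norm hF hs⟩
  refine (ae_restrict_iff' measurableSet_Ioc).2 (Eventually.of_forall fun τ hτ => ?_)
  exact (summable_weight_mul ha hQ hB (sub_nonneg.2 hτ.2) fun j => hb j τ).hasSum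

/-- The solution of `y' = b - a Q ^ (-m) y`, `y(0) = c`. -/
def mode (a Q : ℝ) (m : ℤ) (c : ℂ) (b : ℝ → ℂ) (t : ℝ) : ℂ :=
  (decay a Q m t : ℂ) * c + ∫ τ in (0 : ℝ)..t, (decay a Q m (t - τ) : ℂ) * b τ

/-- The integrating factor removes t from the integrand, so the fundamental theorem of calculus
applies. -/
theorem mode_eq (m : ℤ) (c : ℂ) (b : ℝ → ℂ) (t : ℝ) :
    mode a Q m c b t = (decay a Q m t : ℂ) *
      (c + ∫ τ in (0 : ℝ)..t, ((Real.exp (a * τ * Q ^ (-m)) : ℝ) : ℂ) * b τ) := by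
  rw [mode, mul_add, ← intervalIntegral.integral_const_mul]
  congr 1
  refine intervalIntegral.integral_congr fun τ _ => ?_
  simp only [decay]
  rw [← mul_assoc, ← Complex.ofReal_mul, ← Real.exp_add]
  ring_nf

theorem continuous_mode (m : ℤ) (c : ℂ) {b : ℝ → ℂ}
    (hb : ∀ s t, IntervalIntegrable b volume s t) : Continuous (mode a Q m c b) := by
  have e : mode a Q m c b = fun t => (decay a Q m t : ℂ) *
      (c + ∫ τ in (0 : ℝ)..t, ((Real.exp (a * τ * Q ^ (-m)) : ℝ) : ℂ) * b τ) :=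
    funext (mode_eq m c b)
  rw [e]
  refine (Complex.continuous_ofReal.comp continuous_decay).mul (continuous_const.add ?_)
  exact intervalIntegral.continuous_primitive (fun s t =>
    intervalIntegrable_mul_of_continuous (k := fun τ => Real.exp (a * τ * Q ^ (-m)))
      (by fun_prop) (hb s t)) 0

theorem hasDerivAt_mode (m : ℤ) (c : ℂ) {b : ℝ → ℂ} {t : ℝ}
    (hb : ∀ s t, IntervalIntegrable b volume s t) (hc : ∀ᶠ s in 𝓝 t, ContinuousAt b s) :
    HasDerivAt (mode a Q m c b) (b t - a * Q ^ (-m) * mode a Q m c b t) t := by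
  have e : mode a Q m c b = fun t => (decay a Q m t : ℂ) *
      (c + ∫ τ in (0 : ℝ)..t, ((Real.exp (a * τ * Q ^ (-m)) : ℝ) : ℂ) * b τ) :=
    funext (mode_eq m c b)
  have hk : Continuous fun τ : ℝ => ((Real.exp (a * τ * Q ^ (-m)) : ℝ) : ℂ) := by fun_prop
  have h1 : HasDerivAt (fun t => ((decay a Q m t : ℝ) : ℂ))
      ((-(a * Q ^ (-m)) * decay a Q m t : ℝ) : ℂ) t := by
    refine HasDerivAt.ofReal_comp ?_
    have h0 : HasDerivAt (fun t => -(a * t * Q ^ (-m))) (-(a * Q ^ (-m))) t := by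
      have := (((hasDerivAt_id t).const_mul a).mul_const (Q ^ (-m))).neg
      rw [mul_one] at this
      exact this
    rw [mul_comm]
    exact h0.exp
  have h2 : HasDerivAt (fun t => c + ∫ τ in (0 : ℝ)..t,
      ((Real.exp (a * τ * Q ^ (-m)) : ℝ) : ℂ) * b τ)
      (((Real.exp (a * t * Q ^ (-m)) : ℝ) : ℂ) * b t) t := by
    refine HasDerivAt.const_add c ?_
    have hcont : ∀ᶠ s in 𝓝 t, ContinuousAt
        (fun τ => ((Real.exp (a * τ * Q ^ (-m)) : ℝ) : ℂ) * b τ) s :=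
      hc.mono fun s hs => hk.continuousAt.mul hs
    refine intervalIntegral.integral_hasDerivAt_right
      (intervalIntegrable_mul_of_continuous (k := fun τ => Real.exp (a * τ * Q ^ (-m)))
        (by fun_prop) (hb 0 t)) ?_ hcont.self_of_nhds
    obtain ⟨U, hU, hUo, htU⟩ := eventually_nhds_iff.1 hcont
    exact ⟨U, hUo.mem_nhds htU, ContinuousOn.aestronglyMeasurable
      (fun s hs => (hU s hs).continuousWithinAt) hUo.measurableSet⟩
  have h3 := h1.mul h2
  have h4 : ((decay a Q m t : ℝ) : ℂ) * ((Real.exp (a * t * Q ^ (-m)) : ℝ) : ℂ) = 1 := by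
    rw [← Complex.ofReal_mul, decay, ← Real.exp_add, neg_add_cancel, Real.exp_zero,
      Complex.ofReal_one]
  rw [mode_eq, e]
  refine h3.congr_deriv ?_
  rw [← mul_assoc _ _ (b t), h4]
  push_cast
  ring

theorem norm_mode_le (ha : 0 ≤ a) (hQ : 0 ≤ Q) {m : ℤ} {c : ℂ} {b : ℝ → ℂ} {t M : ℝ} (ht : 0 ≤ t)
    (hc : ‖c‖ ≤ M) (hb : ∀ τ, ‖b τ‖ ≤ M) : ‖mode a Q m c b t‖ ≤ M * (1 + t) := by
  have key : ∀ s : ℝ, 0 ≤ s → ∀ z : ℂ, ‖z‖ ≤ M → ‖(decay a Q m s : ℂ) * z‖ ≤ M := by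
    intro s hs z hz
    rw [norm_mul, Complex.norm_real, Real.norm_of_nonneg decay_pos.le]
    exact (mul_le_of_le_one_left (norm_nonneg _) (decay_le_one ha hQ hs)).trans hz
  have h2 : ‖∫ τ in (0 : ℝ)..t, (decay a Q m (t - τ) : ℂ) * b τ‖ ≤ M * |t - 0| :=
    intervalIntegral.norm_integral_le_of_norm_le_const fun τ hτ => by
      rw [uIoc_of_le ht] at hτ
      exact key _ (sub_nonneg.2 hτ.2) _ (hb τ)
  rw [sub_zero, abs_of_nonneg ht] at h2
  exact (norm_add_le _ _).trans (by linarith [key t ht c hc])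

/-- The contribution of the average over the ball of radius `p ^ j` to the solution. -/
def modeDiff (a Q : ℝ) (j : ℤ) (c : ℂ) (b : ℝ → ℂ) (t : ℝ) : ℂ :=
  mode a Q j c b t - mode a Q (j - 1) c b t

theorem intervalIntegrable_decay_mul (m : ℤ) {b : ℝ → ℂ} {t : ℝ}
    (hb : IntervalIntegrable b volume 0 t) :
    IntervalIntegrable (fun τ => (decay a Q m (t - τ) : ℂ) * b τ) volume 0 t :=
  intervalIntegrable_mul_of_continuous (k := fun τ => decay a Q m (t - τ))
    (continuous_decay.comp (by fun_prop)) hb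

theorem modeDiff_eq (j : ℤ) (c : ℂ) {b : ℝ → ℂ} {t : ℝ}
    (hb : IntervalIntegrable b volume 0 t) :
    modeDiff a Q j c b t = (weight a Q j t : ℂ) * c +
      ∫ τ in (0 : ℝ)..t, (weight a Q j (t - τ) : ℂ) * b τ := by
  simp only [modeDiff, mode, weight, Complex.ofReal_sub, sub_mul]
  rw [intervalIntegral.integral_sub (intervalIntegrable_decay_mul j hb)
    (intervalIntegrable_decay_mul (j - 1) hb)]
  ring

/-- Each mode is bounded only by a multiple of M, which may grow like p^(λj). The difference of
neighbouring modes carries weights instead of decay factors and so gains the summable factor Q^(-j).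
-/
theorem norm_modeDiff_le (ha : 0 ≤ a) (hQ : 1 < Q) {j : ℤ} {c : ℂ} {b : ℝ → ℂ} {t T M : ℝ}
    (ht : 0 ≤ t) (htT : t ≤ T) (hi : IntervalIntegrable b volume 0 t)
    (hc : ‖c‖ ≤ M) (hb : ∀ τ, ‖b τ‖ ≤ M) :
    ‖modeDiff a Q j c b t‖ ≤ a * T * Q * (1 + T) * (Q ^ (-j) * M) := by
  have hM : 0 ≤ M := (norm_nonneg c).trans hc
  have hT : 0 ≤ T := ht.trans htT
  have h2 : ‖∫ τ in (0 : ℝ)..t, (weight a Q j (t - τ) : ℂ) * b τ‖ ≤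
      a * T * Q * (Q ^ (-j) * M) * |t - 0| :=
    intervalIntegral.norm_integral_le_of_norm_le_const fun τ hτ => by
      rw [uIoc_of_le ht] at hτ
      exact norm_weight_mul_le ha hQ (sub_nonneg.2 hτ.2) (by linarith [hτ.1]) (hb τ)
  rw [sub_zero, abs_of_nonneg ht] at h2
  have h3 : a * T * Q * (Q ^ (-j) * M) * t ≤ a * T * Q * (Q ^ (-j) * M) * T := by gcongr
  rw [modeDiff_eq j c hi]
  refine (norm_add_le _ _).trans ?_
  linarith [norm_weight_mul_le (T := T) (j := j) ha hQ ht htT hc]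

theorem zpow_neg_sub_one (hQ : 1 < Q) (j : ℤ) : Q ^ (-(j - 1)) = Q * Q ^ (-j) := by
  rw [neg_sub, sub_eq_add_neg, zpow_add₀ (by linarith), zpow_one]

/-- The derivative of `modeDiff`, up to the factor `-a`. -/
def modeGen (a Q : ℝ) (j : ℤ) (c : ℂ) (b : ℝ → ℂ) (t : ℝ) : ℂ :=
  ((Q ^ (-j) - Q ^ (-(j - 1)) : ℝ) : ℂ) * mode a Q j c b t +
    ((Q ^ (-(j - 1)) : ℝ) : ℂ) * modeDiff a Q j c b t

/-- The source cancels between the two modes, leaving Q^(-j) times the mode j minus Q^(-(j-1)) times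
the mode j - 1; `modeGen` groups this in the form that summation by parts produces. -/
theorem hasDerivAt_modeDiff (j : ℤ) (c : ℂ) {b : ℝ → ℂ} {t : ℝ}
    (hb : ∀ s t, IntervalIntegrable b volume s t) (hc : ∀ᶠ s in 𝓝 t, ContinuousAt b s) :
    HasDerivAt (modeDiff a Q j c b) (-(a : ℂ) * modeGen a Q j c b t) t := by
  refine ((hasDerivAt_mode j c hb hc).sub (hasDerivAt_mode (j - 1) c hb hc)).congr_deriv ?_
  simp only [modeGen, modeDiff]
  push_cast
  ring

theorem norm_modeGen_le (ha : 0 ≤ a) (hQ : 1 < Q) {j : ℤ} {c : ℂ} {b : ℝ → ℂ} {t T M : ℝ}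
    (ht : 0 ≤ t) (htT : t ≤ T) (hc : ‖c‖ ≤ M) (hb : ∀ τ, ‖b τ‖ ≤ M) :
    ‖modeGen a Q j c b t‖ ≤ 3 * Q * (1 + T) * (Q ^ (-j) * M) := by
  have hM : 0 ≤ M := (norm_nonneg c).trans hc
  have hQ0 : 0 ≤ Q := by linarith
  have h1 : ∀ m, ‖mode a Q m c b t‖ ≤ M * (1 + T) := fun m =>
    (norm_mode_le ha hQ0 ht hc hb).trans (by gcongr)
  have h2 : ‖modeDiff a Q j c b t‖ ≤ 2 * (M * (1 + T)) :=
    (norm_sub_le _ _).trans (by linarith [h1 j, h1 (j - 1)])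
  have hz : 0 ≤ Q ^ (-j) := by positivity
  have h3 : ‖((Q ^ (-j) - Q ^ (-(j - 1)) : ℝ) : ℂ)‖ ≤ Q * Q ^ (-j) := by
    rw [Complex.norm_real, zpow_neg_sub_one hQ, Real.norm_eq_abs, abs_le]
    constructor <;> nlinarith
  have h4 : ‖((Q ^ (-(j - 1)) : ℝ) : ℂ)‖ = Q * Q ^ (-j) := by
    rw [Complex.norm_real, zpow_neg_sub_one hQ, Real.norm_of_nonneg (by positivity)]
  refine (norm_add_le _ _).trans ?_
  rw [norm_mul, norm_mul, h4]
  calc _ ≤ Q * Q ^ (-j) * (M * (1 + T)) + Q * Q ^ (-j) * (2 * (M * (1 + T))) := by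
        gcongr; exact h1 j
    _ = _ := by ring

section series

variable {c : ℤ → ℂ} {b : ℤ → ℝ → ℂ}

theorem summable_modeDiff (ha : 0 ≤ a) (hQ : 1 < Q) (hB : Summable fun j => Q ^ (-j) * B j)
    (hc : ∀ j, ‖c j‖ ≤ B j) (hb : ∀ j τ, ‖b j τ‖ ≤ B j)
    (hi : ∀ j s t, IntervalIntegrable (b j) volume s t) {t : ℝ} (ht : 0 ≤ t) :
    Summable fun j => modeDiff a Q j (c j) (b j) t :=
  (hB.mul_left _).of_norm_bounded fun j =>
    norm_modeDiff_le ha hQ ht le_rfl (hi j 0 t) (hc j) (hb j)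

theorem continuousOn_tsum_modeDiff (ha : 0 ≤ a) (hQ : 1 < Q)
    (hB : Summable fun j => Q ^ (-j) * B j)
    (hc : ∀ j, ‖c j‖ ≤ B j) (hb : ∀ j τ, ‖b j τ‖ ≤ B j)
    (hi : ∀ j s t, IntervalIntegrable (b j) volume s t) (T : ℝ) :
    ContinuousOn (fun t => ∑' j, modeDiff a Q j (c j) (b j) t) (Icc 0 T) :=
  continuousOn_tsum (fun j => ((continuous_mode j _ (hi j)).sub
    (continuous_mode (j - 1) _ (hi j))).continuousOn) (hB.mul_left _) fun j _ ht =>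
    norm_modeDiff_le ha hQ ht.1 ht.2 (hi j 0 _) (hc j) (hb j)

theorem summable_modeGen (ha : 0 ≤ a) (hQ : 1 < Q) (hB : Summable fun j => Q ^ (-j) * B j)
    (hc : ∀ j, ‖c j‖ ≤ B j) (hb : ∀ j τ, ‖b j τ‖ ≤ B j) {t : ℝ} (ht : 0 ≤ t) :
    Summable fun j => modeGen a Q j (c j) (b j) t :=
  (hB.mul_left _).of_norm_bounded fun j => norm_modeGen_le ha hQ ht le_rfl (hc j) (hb j)

theorem hasDerivAt_tsum_modeDiff (ha : 0 ≤ a) (hQ : 1 < Q)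
    (hB : Summable fun j => Q ^ (-j) * B j)
    (hc : ∀ j, ‖c j‖ ≤ B j) (hb : ∀ j τ, ‖b j τ‖ ≤ B j)
    (hi : ∀ j s t, IntervalIntegrable (b j) volume s t)
    (hcont : ∀ j, ContinuousOn (b j) (Ioi 0)) {t : ℝ} (ht : 0 < t) :
    HasDerivAt (fun t => ∑' j, modeDiff a Q j (c j) (b j) t)
      (-(a : ℂ) * ∑' j, modeGen a Q j (c j) (b j) t) t := by
  rw [← tsum_mul_left]
  -- A bounded open interval around t gives derivative bounds uniform in time.
  have hmem : t ∈ Ioo 0 (t + 1) := ⟨ht, by linarith⟩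
  refine hasDerivAt_tsum_of_isPreconnected (g := fun j => modeDiff a Q j (c j) (b j))
    (g' := fun j t => -(a : ℂ) * modeGen a Q j (c j) (b j) t)
    (hB.mul_left (a * (3 * Q * (1 + (t + 1))))) isOpen_Ioo isPreconnected_Ioo (fun j s hs => ?_)
    (fun j s hs => ?_) hmem (summable_modeDiff ha hQ hB hc hb hi ht.le) hmem
  · refine hasDerivAt_modeDiff j (c j) (hi j) ?_
    filter_upwards [Ioi_mem_nhds hs.1] with r hr
    exact (hcont j).continuousAt (Ioi_mem_nhds hr)
  · rw [norm_mul, norm_neg, Complex.norm_real, Real.norm_of_nonneg ha, mul_assoc a]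
    exact mul_le_mul_of_nonneg_left
      (norm_modeGen_le ha hQ hs.1.le hs.2.le (hc j) (hb j)) ha

end series

theorem sum_Ioc_eq_sum_range (F : ℤ → ℂ) (l : ℤ) (N : ℕ) :
    ∑ j ∈ Finset.Ioc l (l + N), F j = ∑ k ∈ Finset.range N, F (l + 1 + k) := by
  induction N with
  | zero => simp
  | succ N ih =>
    have h : Finset.Ioc l (l + (N + 1 : ℕ)) = insert (l + 1 + (N : ℤ)) (Finset.Ioc l (l + N)) := by
      ext j
      simp only [Finset.mem_insert, Finset.mem_Ioc]
      lia
    rw [Finset.sum_range_succ, ← ih, h, Finset.sum_insert (by simp), add_comm]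

theorem tendsto_sum_Ioc {F : ℤ → ℂ} {s : ℂ} (hF : HasSum F s) {l : ℤ} (h0 : ∀ j ≤ l, F j = 0) :
    Tendsto (fun N : ℕ => ∑ j ∈ Finset.Ioc l (l + N), F j) atTop (𝓝 s) := by
  have hinj : Function.Injective fun k : ℕ => l + 1 + (k : ℤ) := fun a b h => by simpa using h
  simp only [sum_Ioc_eq_sum_range]
  refine ((hinj.hasSum_iff fun j hj => h0 j ?_).2 hF).tendsto_sum_nat
  by_contra! hc
  exact hj ⟨(j - (l + 1)).toNat, by simp only; lia⟩

/-- Summation by parts for the series of deviations. -/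
theorem hasSum_unique_of_summation_by_parts {μ : ℤ → ℂ} (hμ : Tendsto μ atTop (𝓝 0))
    {U H V : ℤ → ℂ} {l : ℤ} (hV : Summable V) (hV0 : ∀ j ≤ l, V j = 0) (hH0 : ∀ j ≤ l, H j = 0)
    (hU : ∀ i, U i = H i - ∑ j ∈ Finset.Ioc l i, V j) {s s' : ℂ}
    (hs : HasSum (fun i => (μ i - μ (i - 1)) * U i) s)
    (hs' : HasSum (fun i => (μ i - μ (i - 1)) * H i + μ (i - 1) * V i) s') : s = s' := by
  have hU0 : ∀ i ≤ l, U i = 0 := fun i hi => by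
    rw [hU, hH0 i hi, Finset.Ioc_eq_empty (by lia)]; simp
  have h1 := tendsto_sum_Ioc (hs.sub hs') (l := l) fun i hi => by
    simp [hU0 i hi, hH0 i hi, hV0 i hi]
  -- With S_i the partial sum of V, each summand is -(μ_i S_i - μ_(i-1) S_(i-1)). The boundary term
  -- μ_N S_N tends to 0 since S converges and μ tends to 0.
  have h2 : ∀ N : ℕ, ∑ i ∈ Finset.Ioc l (l + N), ((μ i - μ (i - 1)) * U i -
      ((μ i - μ (i - 1)) * H i + μ (i - 1) * V i)) =
      -(μ (l + N) * ∑ j ∈ Finset.Ioc l (l + N), V j) := by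
    intro N
    rw [sum_Ioc_eq_sum_range]
    induction N with
    | zero => simp
    | succ N ih =>
      rw [Finset.sum_range_succ, ih, hU, show l + 1 + (N : ℤ) = l + ((N + 1 : ℕ) : ℤ) by
        push_cast; ring, sum_Ioc_eq_sum_range, sum_Ioc_eq_sum_range, Finset.sum_range_succ]
      rw [show l + ((N + 1 : ℕ) : ℤ) - 1 = l + N by push_cast; ring,
        show l + 1 + (N : ℤ) = l + ((N + 1 : ℕ) : ℤ) by push_cast; ring]
      ring
  simp only [h2] at h1
  have h3 : Tendsto (fun N : ℕ => l + (N : ℤ)) atTop atTop :=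
    tendsto_atTop_add_const_left _ _ tendsto_natCast_atTop_atTop
  have h4 := ((hμ.comp h3).mul (tendsto_sum_Ioc hV.hasSum hV0)).neg
  rw [zero_mul, neg_zero] at h4
  exact sub_eq_zero.1 (tendsto_nhds_unique h1 h4)

end modes

/-! ### The heat flow, the Duhamel solution and its equation -/

section solution

variable {lam C α a : ℝ}

/-- The bound on deviations of functions of growth `lam` that are constant on the ball of
radius `p ^ l`. -/
def devSeq (p : ℕ) (lam C r : ℝ) (l j : ℤ) : ℝ :=
  if l < j then devBound p lam C r l * ((p : ℝ) ^ lam) ^ j else 0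

theorem summable_devSeq (hlamα : lam < α) (r : ℝ) (l : ℤ) :
    Summable fun j => ((p : ℝ) ^ α) ^ (-j) * devSeq p lam C r l j := by
  have hp := prime_cast_pos p
  refine ((summable_Ioi_zpow (by positivity) (rpow_ratio_lt_one p hlamα) l).mul_left
    (devBound p lam C r l)).congr fun j => ?_
  rw [devSeq]
  split_ifs
  · rw [mul_zpow, inv_zpow']; ring
  · simp

section flow

variable {Q : ℝ} {g : (Fin n → ℚ_[p]) → ℂ} {l : (Fin n → ℚ_[p]) → ℤ} {s : ℝ}

theorem norm_avgDev_le_devSeq (hlam : 0 ≤ lam) (hC : 0 ≤ C)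
    (hg : ∀ x, ‖g x‖ ≤ C * (1 + ‖x‖ ^ lam)) {x : Fin n → ℚ_[p]} {m : ℤ} (hl : ConstAt m g x)
    (j : ℤ) : ‖avgDev j g x‖ ≤ devSeq p lam C ‖x‖ m j := by
  rw [devSeq]
  split_ifs with hj
  · exact (norm_avgDev_le_growth hlam hC hg j).trans
      (growth_le_devBound hlam hC (norm_nonneg x) hj)
  · rw [avgDev_of_constAt hl (not_lt.1 hj), norm_zero]

theorem ConstAt.avgDev {x : Fin n → ℚ_[p]} {m : ℤ} (h : ConstAt m g x) (j : ℤ) :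
    ConstAt m (avgDev j g) x := by
  rw [constAt_iff]
  intro y hy
  rw [PadicHeat.avgDev, PadicHeat.avgDev, constAt_iff.1 (h.ballAvg j) y hy, constAt_iff.1 h y hy]

/-- The heat semigroup, written as a superposition of ball averages. -/
def heatFlow (a Q s : ℝ) (g : (Fin n → ℚ_[p]) → ℂ) (x : Fin n → ℚ_[p]) : ℂ :=
  g x + ∑' j, (weight a Q j s : ℂ) * avgDev j g x

theorem ConstAt.heatFlow {x : Fin n → ℚ_[p]} {m : ℤ} (h : ConstAt m g x) (a Q s : ℝ) :
    ConstAt m (heatFlow a Q s g) x := by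
  rw [constAt_iff]
  intro y hy
  simp only [PadicHeat.heatFlow, constAt_iff.1 h y hy, constAt_iff.1 (h.avgDev _) y hy]

theorem heatFlow_eq_integral (ha : 0 < a) (hα : 0 < α) (hlam : 0 ≤ lam)
    (hlamα : lam < α) (hs : 0 < s) (hC : 0 ≤ C) (hgc : Continuous g)
    (hg : ∀ x, ‖g x‖ ≤ C * (1 + ‖x‖ ^ lam)) (x : Fin n → ℚ_[p]) :
    heatFlow a ((p : ℝ) ^ α) s g x = ∫ ξ, heatKernel a α (x - ξ) s * g ξ := by
  rw [heatFlow, (hasSum_weight_mul_avgDev ha hα hlam hlamα hs hC hgc hg x).tsum_eq,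
    add_sub_cancel]

theorem ballAvg_avgDev (hg : Continuous g) (i j : ℤ) (x : Fin n → ℚ_[p]) :
    ballAvg i (avgDev j g) x = avgDev (max i j) g x - avgDev i g x := by
  have : avgDev j g = fun z => ballAvg j g z - g z := rfl
  rw [this, ballAvg_sub (continuous_ballAvg j) hg, ballAvg_ballAvg hg, avgDev, avgDev]
  ring

theorem avgDev_add {f g : (Fin n → ℚ_[p]) → ℂ} (hf : Continuous f) (hg : Continuous g) (j : ℤ)
    (x : Fin n → ℚ_[p]) :
    avgDev j (fun z => f z + g z) x = avgDev j f x + avgDev j g x := by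
  rw [avgDev, ballAvg_add hf hg, avgDev, avgDev]
  ring

/-- By `ballAvg_avgDev` the average A_i acts on the j-th term through the deviation of index max(i,
j). After subtraction of the flow at x, a term with j ≤ i leaves minus its own deviation, and a term
with j > i minus the i-th one. The weights above i have sum 1 minus the decay factor, and the terms
with j ≤ l(x) vanish. -/
theorem avgDev_heatFlow (ha : 0 < a) (hα : 0 < α) (hlam : 0 ≤ lam) (hlamα : lam < α)
    (hs : 0 ≤ s) (hC : 0 ≤ C) (hl : ∀ x, ConstAt (l x) g x)
    (hg : ∀ x, ‖g x‖ ≤ C * (1 + ‖x‖ ^ lam)) (i : ℤ) (x : Fin n → ℚ_[p]) :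
    avgDev i (heatFlow a ((p : ℝ) ^ α) s g) x = (decay a ((p : ℝ) ^ α) i s : ℂ) * avgDev i g x -
      ∑ j ∈ Finset.Ioc (l x) i, (weight a ((p : ℝ) ^ α) j s : ℂ) * avgDev j g x := by
  set Q := (p : ℝ) ^ α with hQdef
  have hQ : 1 < Q := one_lt_prime_rpow p hα
  have hgc : Continuous g := (isLocallyConstant_of_constAt hl).continuous
  have hsum : ∀ z, HasSum (fun j => (weight a Q j s : ℂ) * avgDev j g z)
      (heatFlow a Q s g z - g z) := fun z => by
    have := (summable_weight_mul ha.le hQ (summable_devSeq (C := C) hlamα ‖z‖ (l z)) hs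
      (norm_avgDev_le_devSeq hlam hC hg (hl z))).hasSum
    rwa [heatFlow, add_sub_cancel_left]
  have hconst : ∀ z, ConstAt (l z) (heatFlow a Q s g) z := fun z => (hl z).heatFlow a Q s
  have h1 := hasSum_ballAvg (l := l) (fun j z => by
    rw [constAt_iff]
    intro y hy
    rw [constAt_iff.1 ((hl z).avgDev j) y hy]) hsum i x
  simp only [ballAvg_const_mul, ballAvg_avgDev hgc] at h1
  rw [ballAvg_sub (isLocallyConstant_of_constAt hconst).continuous hgc] at h1
  have h2 := (h1.sub (hsum x)).add
    ((Complex.hasSum_ofReal.2 (hasSum_weight_Ioi ha.le hQ hs i)).mul_right (avgDev i g x))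
  have h3 : HasSum (fun j => if j ∈ Finset.Ioc (l x) i then
      -((weight a Q j s : ℂ) * avgDev j g x) else 0)
      (∑ j ∈ Finset.Ioc (l x) i, -((weight a Q j s : ℂ) * avgDev j g x)) := by
    have := hasSum_sum_of_ne_finset_zero (s := Finset.Ioc (l x) i)
      (f := fun j => if j ∈ Finset.Ioc (l x) i then
        -((weight a Q j s : ℂ) * avgDev j g x) else 0) (L := .unconditional ℤ) fun j hj =>
        if_neg hj
    rwa [Finset.sum_congr rfl fun j hj => if_pos hj] at this
  have h4 := h3.unique (h2.congr_fun fun j => ?_)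
  · rw [Finset.sum_neg_distrib] at h4
    push_cast at h4
    rw [avgDev, sub_eq_add_neg (_ * _), h4, avgDev]
    ring
  · rcases le_or_gt j i with hj | hj
    · rw [if_neg (not_lt.2 hj), max_eq_left hj]
      split_ifs with h
      · simp
      · rw [Finset.mem_Ioc] at h
        rw [avgDev_of_constAt (hl x) (by lia : j ≤ l x)]
        simp
    · rw [if_pos hj, max_eq_right hj.le, if_neg (by rw [Finset.mem_Ioc]; lia)]
      ring

/-- One `M` serves all g and all s ≤ T, so the bound can be integrated over the source slices. The
weights have sum 1 for s > 0 and p^(λj) ≤ 1 for j ≤ 0; for j > 0 the bound Q^(-j) p^(λj) is summed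
into `S`. -/
theorem exists_norm_heatFlow_le (p : ℕ) [Fact p.Prime] (n : ℕ) (ha : 0 < a) (hα : 0 < α)
    (hlam : 0 ≤ lam) (hlamα : lam < α) (T : ℝ) :
    ∃ M : ℝ, 0 ≤ M ∧ ∀ (C s : ℝ) (g : (Fin n → ℚ_[p]) → ℂ), 0 ≤ C → 0 ≤ s → s ≤ T →
      Continuous g → (∀ x, ‖g x‖ ≤ C * (1 + ‖x‖ ^ lam)) → ∀ x,
      ‖heatFlow a ((p : ℝ) ^ α) s g x‖ ≤ C * M * (1 + ‖x‖ ^ lam) := by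
  have hp := prime_cast_pos p
  set Q := (p : ℝ) ^ α with hQdef
  have hQ : 1 < Q := one_lt_prime_rpow p hα
  set R := (p : ℝ) ^ lam with hR
  have hR1 : 1 ≤ R := Real.one_le_rpow (one_lt_prime_cast p).le hlam
  have hsum := (summable_Ioi_zpow (by positivity) (rpow_ratio_lt_one p hlamα) 0)
  rw [← hQdef, ← hR] at hsum
  set S := ∑' j : ℤ, (if 0 < j then (Q⁻¹ * R) ^ j else 0) with hS
  have hS0 : 0 ≤ S := tsum_nonneg fun j => by positivity
  refine ⟨2 + a * |T| * Q * S, by positivity, fun C s g hC hs0 hsT hgc hg x => ?_⟩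
  have hM2 : 0 ≤ a * |T| * Q * S := by positivity
  have hx0 : 0 ≤ 1 + ‖x‖ ^ lam := by positivity
  rcases hs0.eq_or_lt with rfl | hs
  · simp only [heatFlow, weight_zero_time, Complex.ofReal_zero, zero_mul, tsum_zero, add_zero]
    refine (hg x).trans (mul_le_mul_of_nonneg_right ?_ hx0)
    exact le_mul_of_one_le_right hC (by linarith)
  rw [heatFlow_eq_integral ha hα hlam hlamα hs hC hgc hg,
    ← (integrable_and_hasSum_heatKernel_mul ha hα hlam hlamα hs hC hgc hg x).2.tsum_eq]
  have hw := hasSum_weight ha hQ hs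
  have hb : HasSum (fun j => C * ((1 + ‖x‖ ^ lam) * weight a Q j s +
      (weight a Q j s + a * |T| * Q * (if 0 < j then (Q⁻¹ * R) ^ j else 0))))
      (C * ((1 + ‖x‖ ^ lam) * 1 + (1 + a * |T| * Q * S))) :=
    ((hw.mul_left _).add (hw.add (hsum.hasSum.mul_left _))).mul_left C
  refine (tsum_of_norm_bounded hb fun j => ?_).trans ?_
  · have h0 := weight_nonneg (j := j) ha.le hQ hs.le
    rw [norm_mul, Complex.norm_real, Real.norm_of_nonneg h0]
    refine (mul_le_mul_of_nonneg_left (norm_ballAvg_le_growth hlam hC hg j x) h0).trans ?_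
    rw [← hR, mul_left_comm, mul_add, mul_comm (weight a Q j s) (1 + ‖x‖ ^ lam)]
    refine mul_le_mul_of_nonneg_left (add_le_add le_rfl ?_) hC
    split_ifs with hj
    · rw [mul_zpow, inv_zpow']
      have h1 : weight a Q j s ≤ a * |T| * Q * Q ^ (-j) := (weight_le ha.le hQ hs.le).trans
        (by gcongr; exact hsT.trans (le_abs_self T))
      have h2 := mul_le_mul_of_nonneg_right h1 (by positivity : 0 ≤ R ^ j)
      linarith
    · have h1 : R ^ j ≤ 1 := zpow_le_one_of_nonpos₀ hR1 (not_lt.1 hj)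
      rw [mul_zero, add_zero]
      exact mul_le_of_le_one_right h0 h1
  · have h1 : 0 ≤ ‖x‖ ^ lam := by positivity
    rw [mul_assoc C]
    refine mul_le_mul_of_nonneg_left ?_ hC
    nlinarith

end flow

theorem intervalIntegrable_finset_sum {ι : Type*} {s : Finset ι} {F : ι → ℝ → ℂ} {c d : ℝ}
    (h : ∀ i, IntervalIntegrable (F i) volume c d) :
    IntervalIntegrable (fun τ => ∑ i ∈ s, F i τ) volume c d := by
  have := IntervalIntegrable.sum s fun i _ => h i
  rwa [Finset.sum_fn] at this

theorem intervalIntegrable_of_bounded {b : ℝ → ℂ} {M : ℝ} (hc : ContinuousOn b (Ioi 0))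
    (h0 : ∀ t ≤ 0, b t = 0) (hb : ∀ t, ‖b t‖ ≤ M) (s t : ℝ) :
    IntervalIntegrable b volume s t := by
  have hm : AEStronglyMeasurable b volume := by
    have e : b = (Ioi (0 : ℝ)).indicator b := by
      funext t
      by_cases ht : t ∈ Ioi (0 : ℝ)
      · rw [indicator_of_mem ht]
      · rw [indicator_of_notMem ht, h0 t (not_lt.1 ht)]
    rw [e, aestronglyMeasurable_indicator_iff measurableSet_Ioi]
    exact hc.aestronglyMeasurable measurableSet_Ioi
  exact (intervalIntegrable_const (c := M)).mono_fun hm.restrict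
    (Eventually.of_forall fun t => (hb t).trans (le_abs_self M))

/-- Source terms on the whole time axis: zero up to time `0`, continuous in time afterwards, with
growth bounds and radii of constancy that do not depend on time. -/
structure IsSource (lam C : ℝ) (l : (Fin n → ℚ_[p]) → ℤ)
    (f : (Fin n → ℚ_[p]) → ℝ → ℂ) : Prop where
  constAt : ∀ t x, ConstAt (l x) (fun z => f z t) x
  growth : ∀ t x, ‖f x t‖ ≤ C * (1 + ‖x‖ ^ lam)
  continuousOn : ∀ x, ContinuousOn (f x) (Ioi 0)
  eq_zero : ∀ x, ∀ t ≤ 0, f x t = 0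

/-- The solution of the Cauchy problem with initial value `φ` and source `f`. -/
def heatSolution (a Q : ℝ) (φ : (Fin n → ℚ_[p]) → ℂ) (f : (Fin n → ℚ_[p]) → ℝ → ℂ)
    (x : Fin n → ℚ_[p]) (t : ℝ) : ℂ :=
  heatFlow a Q t φ x + ∫ τ in (0 : ℝ)..t, heatFlow a Q (t - τ) (fun z => f z τ) x

variable {l : (Fin n → ℚ_[p]) → ℤ} {φ : (Fin n → ℚ_[p]) → ℂ}
  {f : (Fin n → ℚ_[p]) → ℝ → ℂ}

theorem constAt_heatSolution {m : ℤ} {x : Fin n → ℚ_[p]} (hφ : ConstAt m φ x)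
    (hf : ∀ t, ConstAt m (fun z => f z t) x) (a Q t : ℝ) :
    ConstAt m (fun z => heatSolution a Q φ f z t) x := by
  rw [constAt_iff]
  intro y hy
  simp only [heatSolution, constAt_iff.1 (hφ.heatFlow a Q t) y hy,
    constAt_iff.1 ((hf _).heatFlow a Q _) y hy]

namespace IsSource

theorem continuous (hf : IsSource lam C l f) (t : ℝ) : Continuous fun z => f z t :=
  (isLocallyConstant_of_constAt (hf.constAt t)).continuous

theorem intervalIntegrable (hf : IsSource lam C l f) (x : Fin n → ℚ_[p]) (s t : ℝ) :
    IntervalIntegrable (f x) volume s t :=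
  intervalIntegrable_of_bounded (hf.continuousOn x) (hf.eq_zero x) (fun t => hf.growth t x) s t

theorem continuousOn_avgDev (hf : IsSource lam C l f) (j : ℤ) (x : Fin n → ℚ_[p]) :
    ContinuousOn (fun τ => avgDev j (fun z => f z τ) x) (Ioi 0) :=
  (continuousOn_ballAvg hf.constAt hf.continuousOn j x).sub (hf.continuousOn x)

theorem norm_avgDev_le (hf : IsSource lam C l f) (hlam : 0 ≤ lam) (hC : 0 ≤ C) (j : ℤ)
    (x : Fin n → ℚ_[p]) (τ : ℝ) :
    ‖avgDev j (fun z => f z τ) x‖ ≤ devSeq p lam C ‖x‖ (l x) j :=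
  norm_avgDev_le_devSeq hlam hC (hf.growth τ) (hf.constAt τ x) j

theorem intervalIntegrable_avgDev (hf : IsSource lam C l f) (hlam : 0 ≤ lam) (hC : 0 ≤ C)
    (j : ℤ) (x : Fin n → ℚ_[p]) (s t : ℝ) :
    IntervalIntegrable (fun τ => avgDev j (fun z => f z τ) x) volume s t :=
  intervalIntegrable_of_bounded (hf.continuousOn_avgDev j x) (fun τ hτ => by
    simp [avgDev, ballAvg, hf.eq_zero _ τ hτ]) (hf.norm_avgDev_le hlam hC j x) s t

theorem intervalIntegrable_heatFlow (hf : IsSource lam C l f) (ha : 0 < a) (hα : 0 < α)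
    (hlam : 0 ≤ lam) (hlamα : lam < α) (hC : 0 ≤ C) (x : Fin n → ℚ_[p]) {t : ℝ} (ht : 0 ≤ t) :
    IntervalIntegrable (fun τ => heatFlow a ((p : ℝ) ^ α) (t - τ) (fun z => f z τ) x)
      volume 0 t :=
  (hf.intervalIntegrable x 0 t).add (intervalIntegrable_and_hasSum_weight ha.le
    (one_lt_prime_rpow p hα) (summable_devSeq hlamα ‖x‖ (l x)) ht
    (fun j => hf.norm_avgDev_le hlam hC j x)
    fun j => hf.intervalIntegrable_avgDev hlam hC j x 0 t).1

end IsSource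

theorem heatSolution_eq_series (ha : 0 < a) (hα : 0 < α) (hlam : 0 ≤ lam) (hlamα : lam < α)
    (hC : 0 ≤ C) (hl : ∀ x, ConstAt (l x) φ x) (hφ : ∀ x, ‖φ x‖ ≤ C * (1 + ‖x‖ ^ lam))
    (hf : IsSource lam C l f) (x : Fin n → ℚ_[p]) {t : ℝ} (ht : 0 ≤ t) :
    heatSolution a ((p : ℝ) ^ α) φ f x t = φ x + (∫ τ in (0 : ℝ)..t, f x τ) +
      ∑' j, modeDiff a ((p : ℝ) ^ α) j (avgDev j φ x)
        (fun τ => avgDev j (fun z => f z τ) x) t := by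
  have hQ := one_lt_prime_rpow p hα
  have hB := summable_devSeq (p := p) (C := C) hlamα ‖x‖ (l x)
  have h := intervalIntegrable_and_hasSum_weight ha.le hQ hB ht
    (fun j => hf.norm_avgDev_le hlam hC j x)
    (fun j => hf.intervalIntegrable_avgDev hlam hC j x 0 t)
  have h2 := (summable_weight_mul ha.le hQ hB ht
    (norm_avgDev_le_devSeq hlam hC hφ (hl x))).hasSum.add h.2
  simp only [modeDiff_eq _ _ (hf.intervalIntegrable_avgDev hlam hC _ x 0 t)]
  rw [h2.tsum_eq, heatSolution]
  simp only [heatFlow]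
  rw [intervalIntegral.integral_add (hf.intervalIntegrable x 0 t) h.1]
  ring

/-- This is `avgDev_heatFlow` applied to φ and, under the time integral, to every source slice:
decay factors integrate to modes and weights to differences of modes. -/
theorem avgDev_heatSolution (ha : 0 < a) (hα : 0 < α) (hlam : 0 ≤ lam) (hlamα : lam < α)
    (hC : 0 ≤ C) (hl : ∀ x, ConstAt (l x) φ x) (hφ : ∀ x, ‖φ x‖ ≤ C * (1 + ‖x‖ ^ lam))
    (hf : IsSource lam C l f) (x : Fin n → ℚ_[p]) {t : ℝ} (ht : 0 ≤ t) (i : ℤ) :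
    avgDev i (fun z => heatSolution a ((p : ℝ) ^ α) φ f z t) x =
      mode a ((p : ℝ) ^ α) i (avgDev i φ x) (fun τ => avgDev i (fun z => f z τ) x) t -
      ∑ j ∈ Finset.Ioc (l x) i, modeDiff a ((p : ℝ) ^ α) j (avgDev j φ x)
        (fun τ => avgDev j (fun z => f z τ) x) t := by
  have hc1 : Continuous (heatFlow a ((p : ℝ) ^ α) t φ) :=
    (isLocallyConstant_of_constAt fun z => (hl z).heatFlow a _ t).continuous
  have hG : ∀ τ z, ConstAt (l z)
      (fun z => heatFlow a ((p : ℝ) ^ α) (t - τ) (fun z => f z τ) z) z := fun τ z =>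
    (hf.constAt τ z).heatFlow a _ _
  have hc2 : Continuous fun z => ∫ τ in (0 : ℝ)..t,
      heatFlow a ((p : ℝ) ^ α) (t - τ) (fun z => f z τ) z := by
    refine (isLocallyConstant_of_constAt (l := l) fun z => constAt_iff.2 fun y hy => ?_).continuous
    simp only [constAt_iff.1 (hG _ z) y hy]
  have hI : ∀ j, IntervalIntegrable (fun τ => avgDev j (fun z => f z τ) x) volume 0 t := fun j =>
    hf.intervalIntegrable_avgDev hlam hC j x 0 t
  have hW : ∀ j, IntervalIntegrable (fun τ => (weight a ((p : ℝ) ^ α) j (t - τ) : ℂ) *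
      avgDev j (fun z => f z τ) x) volume 0 t := fun j =>
    intervalIntegrable_mul_of_continuous (k := fun τ => weight a ((p : ℝ) ^ α) j (t - τ))
      (continuous_weight.comp (by fun_prop)) (hI j)
  have hint : avgDev i (fun z => ∫ τ in (0 : ℝ)..t,
      heatFlow a ((p : ℝ) ^ α) (t - τ) (fun z => f z τ) z) x =
      (∫ τ in (0 : ℝ)..t, (decay a ((p : ℝ) ^ α) i (t - τ) : ℂ) * avgDev i (fun z => f z τ) x) -
        ∑ j ∈ Finset.Ioc (l x) i, ∫ τ in (0 : ℝ)..t, (weight a ((p : ℝ) ^ α) j (t - τ) : ℂ) *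
          avgDev j (fun z => f z τ) x := by
    have hbi : IntervalIntegrable (fun τ => ballAvg i
        (fun z => heatFlow a ((p : ℝ) ^ α) (t - τ) (fun z => f z τ) z) x) volume 0 t := by
      obtain ⟨c, h⟩ := exists_ballAvg_eq_sum l i x
      simp only [h _ (hG _), Finsupp.sum]
      exact intervalIntegrable_finset_sum fun z =>
        (hf.intervalIntegrable_heatFlow ha hα hlam hlamα hC z ht).const_mul _
    rw [avgDev, ballAvg_intervalIntegral hG
      (fun z => hf.intervalIntegrable_heatFlow ha hα hlam hlamα hC z ht),
      ← intervalIntegral.integral_sub hbi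
        (hf.intervalIntegrable_heatFlow ha hα hlam hlamα hC x ht),
      ← intervalIntegral.integral_finsetSum fun j _ => hW j,
      ← intervalIntegral.integral_sub (intervalIntegrable_decay_mul i (hI i))
        (intervalIntegrable_finset_sum hW)]
    refine intervalIntegral.integral_congr fun τ hτ => ?_
    rw [uIcc_of_le ht] at hτ
    exact avgDev_heatFlow ha hα hlam hlamα (sub_nonneg.2 hτ.2) hC (hf.constAt τ) (hf.growth τ) i x
  have := avgDev_add hc1 hc2 i x
  simp only [heatSolution]
  rw [this, hint, avgDev_heatFlow ha hα hlam hlamα ht hC hl hφ]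
  simp only [modeDiff_eq _ _ (hI _), mode, Finset.sum_add_distrib]
  ring

theorem heatSolution_zero (a Q : ℝ) (φ : (Fin n → ℚ_[p]) → ℂ) (f : (Fin n → ℚ_[p]) → ℝ → ℂ)
    (x : Fin n → ℚ_[p]) : heatSolution a Q φ f x 0 = φ x := by
  simp [heatSolution, heatFlow, weight_zero_time]

theorem exists_norm_heatSolution_le (ha : 0 < a) (hα : 0 < α) (hlam : 0 ≤ lam) (hlamα : lam < α)
    (hC : 0 ≤ C) (hl : ∀ x, ConstAt (l x) φ x) (hφ : ∀ x, ‖φ x‖ ≤ C * (1 + ‖x‖ ^ lam))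
    (hf : IsSource lam C l f) (T : ℝ) :
    ∃ C', 0 ≤ C' ∧ ∀ t ∈ Icc 0 T, ∀ x,
      ‖heatSolution a ((p : ℝ) ^ α) φ f x t‖ ≤ C' * (1 + ‖x‖ ^ lam) := by
  obtain ⟨M, hM, h⟩ := exists_norm_heatFlow_le p n ha hα hlam hlamα T
  refine ⟨C * M + C * M * |T|, by positivity, fun t ht x => ?_⟩
  have h1 := h C t φ hC ht.1 ht.2 (isLocallyConstant_of_constAt hl).continuous hφ x
  have h2 : ‖∫ τ in (0 : ℝ)..t, heatFlow a ((p : ℝ) ^ α) (t - τ) (fun z => f z τ) x‖ ≤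
      C * M * (1 + ‖x‖ ^ lam) * |t - 0| :=
    intervalIntegral.norm_integral_le_of_norm_le_const fun τ hτ => by
      rw [uIoc_of_le ht.1] at hτ
      exact h C (t - τ) _ hC (sub_nonneg.2 hτ.2) (by linarith [hτ.1, ht.2]) (hf.continuous τ)
        (hf.growth τ) x
  have h3 : C * M * (1 + ‖x‖ ^ lam) * |t - 0| ≤ C * M * (1 + ‖x‖ ^ lam) * |T| := by
    rw [sub_zero, abs_of_nonneg ht.1]
    gcongr
    exact ht.2.trans (le_abs_self T)
  refine (norm_add_le _ _).trans ?_
  linarith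

theorem continuousOn_heatSolution (ha : 0 < a) (hα : 0 < α) (hlam : 0 ≤ lam) (hlamα : lam < α)
    (hC : 0 ≤ C) (hl : ∀ x, ConstAt (l x) φ x) (hφ : ∀ x, ‖φ x‖ ≤ C * (1 + ‖x‖ ^ lam))
    (hf : IsSource lam C l f) (x : Fin n → ℚ_[p]) (T : ℝ) :
    ContinuousOn (heatSolution a ((p : ℝ) ^ α) φ f x) (Icc 0 T) := by
  have h1 := continuousOn_tsum_modeDiff ha.le (one_lt_prime_rpow p hα)
    (summable_devSeq (p := p) (C := C) hlamα ‖x‖ (l x))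
    (norm_avgDev_le_devSeq hlam hC hφ (hl x)) (fun j => hf.norm_avgDev_le hlam hC j x)
    (fun j => hf.intervalIntegrable_avgDev hlam hC j x) T
  have h2 := intervalIntegral.continuous_primitive (hf.intervalIntegrable x) 0
  refine (((continuousOn_const (c := φ x)).add h2.continuousOn).add h1).congr fun t ht => ?_
  exact heatSolution_eq_series ha hα hlam hlamα hC hl hφ hf x ht.1

/-- D_T^α u is a series in the deviations of u, known from `avgDev_heatSolution`; the termwise time
derivative is a series of `modeGen`. The two sums agree by summation by parts. -/
theorem hasDerivAt_heatSolution (ha : 0 < a) (hα : 0 < α) (hlam : 0 ≤ lam) (hlamα : lam < α)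
    (hC : 0 ≤ C) (hl : ∀ x, ConstAt (l x) φ x) (hφ : ∀ x, ‖φ x‖ ≤ C * (1 + ‖x‖ ^ lam))
    (hf : IsSource lam C l f) (x : Fin n → ℚ_[p]) {t : ℝ} (ht : 0 < t) :
    Integrable (taiblesonIntegrand α (fun z => heatSolution a ((p : ℝ) ^ α) φ f z t) x) ∧
    HasDerivAt (heatSolution a ((p : ℝ) ^ α) φ f x)
      (f x t - a * taibleson α (fun z => heatSolution a ((p : ℝ) ^ α) φ f z t) x) t := by
  have hQ := one_lt_prime_rpow p hα
  have hB := summable_devSeq (p := p) (C := C) hlamα ‖x‖ (l x)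
  have hβ := norm_avgDev_le_devSeq hlam hC hφ (hl x)
  have hb := fun j => hf.norm_avgDev_le hlam hC j x
  have hi := fun j => hf.intervalIntegrable_avgDev hlam hC j x
  have hconst := fun z => constAt_heatSolution (hl z) (fun τ => hf.constAt τ z)
    a ((p : ℝ) ^ α) t
  obtain ⟨C', hC', hgrow⟩ := exists_norm_heatSolution_le ha hα hlam hlamα hC hl hφ hf t
  obtain ⟨hint, hsum⟩ := integrable_and_hasSum_taibleson hα hlam hlamα hC'
    (isLocallyConstant_of_constAt hconst).continuous (hgrow t ⟨ht.le, le_rfl⟩) (hconst x)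
  refine ⟨hint, ?_⟩
  have hgen := (summable_modeGen ha.le hQ hB hβ hb ht.le).hasSum
  have hβ0 : ∀ j ≤ l x, avgDev j φ x = 0 := fun j hj => avgDev_of_constAt (hl x) hj
  have hb0 : ∀ j ≤ l x, ∀ τ, avgDev j (fun z => f z τ) x = 0 := fun j hj τ =>
    avgDev_of_constAt (hf.constAt τ x) hj
  have hμ : Tendsto (fun j : ℤ => (((((p : ℝ) ^ α) ^ (-j) : ℝ)) : ℂ)) atTop (𝓝 0) := by
    have := tendsto_zpow_int_atTop (r := ((p : ℝ) ^ α)⁻¹) (by positivity)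
      (inv_lt_one_of_one_lt₀ hQ)
    simp only [inv_zpow'] at this
    exact (Complex.continuous_ofReal.tendsto' 0 0 Complex.ofReal_zero).comp this
  -- Here μ_j = Q^(-j), so the coefficient (1 - Q) Q^(-j) of the Taibleson series is μ_j - μ_(j-1).
  have key := hasSum_unique_of_summation_by_parts hμ (l := l x)
    (summable_modeDiff ha.le hQ hB hβ hb hi ht.le)
    (fun j hj => by simp [modeDiff, mode, hβ0 j hj, hb0 j hj])
    (fun j hj => by simp [mode, hβ0 j hj, hb0 j hj])
    (avgDev_heatSolution ha hα hlam hlamα hC hl hφ hf x ht.le)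
    (hsum.congr_fun fun j => by
      rw [zpow_neg_sub_one hQ]; push_cast; ring)
    (hgen.congr_fun fun j => by
      rw [modeGen]; push_cast; ring)
  rw [key]
  have hd1 : HasDerivAt (fun t => φ x + ∫ τ in (0 : ℝ)..t, f x τ) (f x t) t := by
    refine HasDerivAt.const_add _ (intervalIntegral.integral_hasDerivAt_right
      (hf.intervalIntegrable x 0 t) ?_ ((hf.continuousOn x).continuousAt (Ioi_mem_nhds ht)))
    exact ⟨Ioi 0, Ioi_mem_nhds ht, (hf.continuousOn x).aestronglyMeasurable measurableSet_Ioi⟩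
  have hd2 := hasDerivAt_tsum_modeDiff ha.le hQ hB hβ hb hi
    (fun j => hf.continuousOn_avgDev j x) ht
  refine ((hd1.add hd2).congr_of_eventuallyEq ?_).congr_deriv (by ring)
  filter_upwards [Ioi_mem_nhds ht] with s hs
  exact heatSolution_eq_series ha hα hlam hlamα hC hl hφ hf x (le_of_lt hs)

end solution

/-! ### Joint continuity and continuation of the source -/

section cauchy

/-- On a ball about x whose radius is independent of t, u(·, t) equals u(x, t), so continuity in t
alone suffices. -/
theorem continuousOn_uncurry_of_constAt {X : Type*} [TopologicalSpace X] {S : Set X}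
    {l : (Fin n → ℚ_[p]) → ℤ} {u : (Fin n → ℚ_[p]) → X → ℂ}
    (hl : ∀ t x, ConstAt (l x) (fun z => u z t) x) (hu : ∀ x, ContinuousOn (u x) S) :
    ContinuousOn (Function.uncurry u) (univ ×ˢ S) := by
  have hp := prime_cast_pos p
  rintro ⟨x, t⟩ ⟨-, ht⟩
  have h1 : ContinuousWithinAt (fun q : (Fin n → ℚ_[p]) × X => u x q.2) (univ ×ˢ S) (x, t) :=
    ContinuousWithinAt.comp (t := S) (hu x t ht) continuous_snd.continuousWithinAt
      fun q hq => hq.2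
  refine h1.congr_of_eventuallyEq (mem_nhdsWithin_of_mem_nhds ?_) rfl
  have hb : Metric.closedBall x ((p : ℝ) ^ l x) ∈ 𝓝 x :=
    Metric.closedBall_mem_nhds _ (by positivity)
  filter_upwards [continuous_fst.continuousAt.preimage_mem_nhds hb] with q hq
  rw [mem_preimage, Metric.mem_closedBall, dist_eq_norm, ← mem_zball] at hq
  have := constAt_iff.1 (hl q.2 x) _ hq
  rwa [add_sub_cancel] at this

/-- The source term on `(0, T]`, continued by its value at `T` and by zero. -/
def extendSource (T : ℝ) (f : (Fin n → ℚ_[p]) → ℝ → ℂ) (x : Fin n → ℚ_[p]) (t : ℝ) : ℂ :=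
  if 0 < t then f x (min t T) else 0

theorem extendSource_of_mem {T t : ℝ} (f : (Fin n → ℚ_[p]) → ℝ → ℂ) (x : Fin n → ℚ_[p])
    (ht : t ∈ Ioc 0 T) : extendSource T f x t = f x t := by
  rw [extendSource, if_pos ht.1, min_eq_left ht.2]

theorem constAt_extendSource {T : ℝ} (hT : 0 < T) {f : (Fin n → ℚ_[p]) → ℝ → ℂ}
    {x : Fin n → ℚ_[p]} {m : ℤ} (h : ∀ t ∈ Ioc 0 T, ConstAt m (fun z => f z t) x) (t : ℝ) :
    ConstAt m (fun z => extendSource T f z t) x := by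
  rw [constAt_iff]
  intro y hy
  simp only [extendSource]
  split_ifs with ht
  · exact constAt_iff.1 (h (min t T) ⟨lt_min ht hT, min_le_right _ _⟩) y hy
  · rfl

theorem isSource_extendSource {T lam C : ℝ} (hT : 0 < T) (hC : 0 ≤ C)
    {f : (Fin n → ℚ_[p]) → ℝ → ℂ} {l : (Fin n → ℚ_[p]) → ℤ}
    (hl : ∀ x, ∀ t ∈ Ioc 0 T, ConstAt (l x) (fun z => f z t) x)
    (hf : ∀ t ∈ Ioc 0 T, ∀ x, ‖f x t‖ ≤ C * (1 + ‖x‖ ^ lam))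
    (hc : ∀ x, ContinuousOn (f x) (Ioc 0 T)) : IsSource lam C l (extendSource T f) where
  constAt t x := constAt_extendSource hT (hl x) t
  growth t x := by
    rw [extendSource]
    split_ifs with ht
    · exact hf _ ⟨lt_min ht hT, min_le_right _ _⟩ x
    · rw [norm_zero]; positivity
  continuousOn x := by
    have : ContinuousOn (fun t => f x (min t T)) (Ioi 0) :=
      (hc x).comp (continuous_id.min continuous_const).continuousOn fun t ht =>
        ⟨lt_min ht hT, min_le_right _ _⟩
    exact this.congr fun t ht => if_pos ht
  eq_zero x t ht := if_neg (not_lt.2 ht)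

end cauchy

end

end PadicHeat

/-! ### The Cauchy problem -/

open PadicHeat in
theorem theorem1 (p : ℕ) [Fact p.Prime] (n : ℕ) (hn : 0 < n) (a α lam T : ℝ)
    (ha : 0 < a) (hα : 0 < α) (hlam : 0 ≤ lam) (hlamα : lam < α) (hT : 0 < T)
    (φ : (Fin n → ℚ_[p]) → ℂ) (f : (Fin n → ℚ_[p]) → ℝ → ℂ)
    (hφ : PadicHeat.MemM lam φ)
    (hf : PadicHeat.UniformMemM lam (Set.Ioc 0 T) f)
    (hfc : ContinuousOn (Function.uncurry f) (Set.univ ×ˢ Set.Ioc 0 T)) :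
    ∃ u : (Fin n → ℚ_[p]) → ℝ → ℂ,
      ContinuousOn (Function.uncurry u) (Set.univ ×ˢ Set.Icc 0 T) ∧
      PadicHeat.UniformMemM lam (Set.Icc 0 T) u ∧
      (∀ l : ℤ, (∀ x, PadicHeat.ConstAt l φ x) →
        (∀ t ∈ Set.Ioc 0 T, ∀ x, PadicHeat.ConstAt l (fun z => f z t) x) →
        ∀ t ∈ Set.Icc 0 T, ∀ x, PadicHeat.ConstAt l (fun z => u z t) x) ∧
      PadicHeat.IsCauchySolution a α T f φ u ∧
      ∀ x, ∀ t ∈ Set.Ioc 0 T,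
        MeasureTheory.Integrable
          (fun ξ : Fin n → ℚ_[p] => PadicHeat.heatKernel a α (x - ξ) t * φ ξ) ∧
        (∀ τ ∈ Set.Ioo 0 t, MeasureTheory.Integrable
          (fun ξ : Fin n → ℚ_[p] => PadicHeat.heatKernel a α (x - ξ) (t - τ) * f ξ τ)) ∧
        IntervalIntegrable (fun τ : ℝ => ∫ ξ : Fin n → ℚ_[p],
          PadicHeat.heatKernel a α (x - ξ) (t - τ) * f ξ τ) MeasureTheory.volume 0 t ∧
        u x t = (∫ ξ : Fin n → ℚ_[p], PadicHeat.heatKernel a α (x - ξ) t * φ ξ) +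
          ∫ τ in (0 : ℝ)..t, ∫ ξ : Fin n → ℚ_[p],
            PadicHeat.heatKernel a α (x - ξ) (t - τ) * f ξ τ := by
  obtain ⟨hφc, Cφ, hφg⟩ := hφ
  obtain ⟨hfl, Cf, hfg⟩ := hf
  choose lφ hlφ using exists_constAt_of_isLocallyConstant hφc
  choose lf hlf using hfl
  set C := max |Cφ| |Cf| with hCdef
  have hC : 0 ≤ C := (abs_nonneg Cφ).trans (le_max_left _ _)
  have hx : ∀ x : Fin n → ℚ_[p], 0 ≤ 1 + ‖x‖ ^ lam := fun x => by positivity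
  have hl : ∀ x, PadicHeat.ConstAt (min (lφ x) (lf x)) φ x := fun x =>
    (hlφ x).mono (min_le_left _ _)
  have hφg' : ∀ x, ‖φ x‖ ≤ C * (1 + ‖x‖ ^ lam) := fun x => (hφg x).trans
    (mul_le_mul_of_nonneg_right ((le_abs_self _).trans (le_max_left _ _)) (hx x))
  -- Continuation of f past T makes the equation hold with a two-sided derivative at every positive
  -- time; the one-sided derivative at T is a restriction of it.
  have hS : PadicHeat.IsSource lam C (fun x => min (lφ x) (lf x)) (extendSource T f) := by
    refine isSource_extendSource hT hC (fun x t ht => (hlf x t ht).mono (min_le_right _ _))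
      (fun t ht x => (hfg t ht x).trans
        (mul_le_mul_of_nonneg_right ((le_abs_self _).trans (le_max_right _ _)) (hx x)))
      fun x => ?_
    exact hfc.comp (Continuous.prodMk_right x).continuousOn fun t ht => ⟨Set.mem_univ _, ht⟩
  have hconst := fun t x => constAt_heatSolution (hl x) (fun τ => hS.constAt τ x)
    a ((p : ℝ) ^ α) t
  obtain ⟨C', -, hC'⟩ := exists_norm_heatSolution_le ha hα hlam hlamα hC hl hφg' hS T
  refine ⟨heatSolution a ((p : ℝ) ^ α) φ (extendSource T f), ?_, ⟨?_, C', hC'⟩, ?_, ⟨?_, ?_⟩, ?_⟩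
  · exact continuousOn_uncurry_of_constAt hconst fun x =>
      continuousOn_heatSolution ha hα hlam hlamα hC hl hφg' hS x T
  · exact fun x => ⟨_, fun t _ => hconst t x⟩
  · exact fun l h1 h2 t _ x => constAt_heatSolution (h1 x)
      (constAt_extendSource hT fun t ht => h2 t ht x) a _ t
  · intro x t ht
    obtain ⟨h1, h2⟩ := hasDerivAt_heatSolution ha hα hlam hlamα hC hl hφg' hS x ht.1
    rw [extendSource_of_mem f x ht] at h2
    exact ⟨h1, _, h2.hasDerivWithinAt, by ring⟩
  · exact heatSolution_zero a _ φ _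
  · intro x t ht
    -- The endpoint τ = t is left out: there the kernel is taken at time 0, where its defining
    -- integral diverges. One point does not affect the time integral.
    have hmem : ∀ τ ∈ Set.Ioo 0 t, τ ∈ Set.Ioc 0 T := fun τ hτ => ⟨hτ.1, hτ.2.le.trans ht.2⟩
    have hext : ∀ τ ∈ Set.Ioo 0 t, (fun z => extendSource T f z τ) = fun z => f z τ :=
      fun τ hτ => funext fun z => extendSource_of_mem f z (hmem τ hτ)
    have hflow : ∀ τ ∈ Set.Ioo 0 t,
        heatFlow a ((p : ℝ) ^ α) (t - τ) (fun z => extendSource T f z τ) x =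
          ∫ ξ, heatKernel a α (x - ξ) (t - τ) * f ξ τ := fun τ hτ => by
      rw [heatFlow_eq_integral ha hα hlam hlamα (sub_pos.2 hτ.2) hC (hS.continuous τ)
        (hS.growth τ)]
      simp only [fun z => congrFun (hext τ hτ) z]
    have hφcont := (isLocallyConstant_of_constAt hl).continuous
    refine ⟨(integrable_and_hasSum_heatKernel_mul ha hα hlam hlamα ht.1 hC hφcont hφg' x).1,
      fun τ hτ => ?_, ?_, ?_⟩
    · have := (integrable_and_hasSum_heatKernel_mul ha hα hlam hlamα (sub_pos.2 hτ.2) hC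
        (hS.continuous τ) (hS.growth τ) x).1
      simpa only [fun z => congrFun (hext τ hτ) z] using this
    · refine (hS.intervalIntegrable_heatFlow ha hα hlam hlamα hC x ht.1.le).congr_uIoo ?_
      rw [Set.uIoo_of_le ht.1.le]
      exact hflow
    · rw [heatSolution, heatFlow_eq_integral ha hα hlam hlamα ht.1 hC hφcont hφg',
        intervalIntegral.integral_congr_Ioo_of_le ht.1.le hflow]
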